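/- **Proposition 2.1 (Center Stable Manifold Theorem for ODE).** Let $1\le k<\infty$ be an integer, let $f:\mathbb R^n\to\mathbb R^n$ be of class $C^{k+1}$, let $u_*$ be an equilibrium, $f(u_*)=0$, and put $A:=df(u_*)$. Let $\Sigma_{cs}$ and $\Sigma_u$ be the real subspaces of $\mathbb R^n$ formed by the vectors that lie in the sum of the generalized (complex) eigenspaces of $A$ for the eigenvalues with real part $\le 0$, respectively $>0$, so that $\mathbb R^n=\Sigma_{cs}\oplus\Sigma_u$. Then $u'=f(u)$ has a local $C^k$ center stable manifold at $u_*$, that is, a set $\mathcal M_{cs}\subset\mathbb R^n$ for which there is an open neighborhood $U$ of $u_*$ such that: 1. (graph, tangency) there is a $C^k$ map $\phi:\Sigma_{cs}\to\Sigma_u$ with $\phi(0)=0$, $d\phi(0)=0$ and $$\mathcal M_{cs}=U\cap\{u_*+v+\phi(v): v\in\Sigma_{cs}\};$$ in particular $\mathcal M_{cs}$ is tangent to $\Sigma_{cs}$ at $u_*$; 2. (local invariance) if $I\subset\mathbb R$ is an interval, $u:I\to U$ is a solution of $u'=f(u)$, and $u(t_0)\in\mathcal M_{cs}$ for some $t_0\in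 I$, then $u(t)\in\mathcal M_{cs}$ for all $t\in I$; 3. (bounded solutions) there is $\delta>0$ such that every solution $u:[0,\infty)\to\mathbb R^n$ of $u'=f(u)$ with $|u(t)-u_*|<\delta$ for all $t\ge 0$ satisfies $u(t)\in\mathcal M_{cs}$ for all $t\ge 0$. In general, $\mathcal M_{cs}$ is not unique: for every integer $k\ge 1$ there are $n$, a $C^{k+1}$ map $f:\mathbb R^n\to\mathbb R^n$ with an equilibrium $u_*$, and two sets $\mathcal M_1,\mathcal M_2$ with the above properties such that $\mathcal M_1\cap V\ne\mathcal M_2\cap V$ for every neighborhood $V$ of $u_*$. -/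

import Mathlib

open scoped Topology ContDiff TensorProduct

/-- For a real endomorphism `A` of `E` and a set `S` of complex numbers (closed under conjugation
in all uses), the real subspace of `E` associated with the eigenvalues of `A` in `S`: the vectors
`v` whose complexification `1 ⊗ v` lies in the sum of the generalized eigenspaces of the
complexified operator for the eigenvalues in `S`. -/
noncomputable def realSpectralSubspace {E : Type*} [AddCommGroup E] [Module ℝ E]
    (A : E →ₗ[ℝ] E) (S : Set ℂ) : Submodule ℝ E :=
  ((⨆ μ ∈ S, Module.End.maxGenEigenspace (LinearMap.baseChange ℂ A) μ).restrictScalars ℝ).comap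
    (TensorProduct.mk ℝ ℂ E 1)

/-- The center stable subspace of `A`: neutral and stable eigenvalues, `Re μ ≤ 0`. -/
noncomputable def centerStableSubspace {E : Type*} [AddCommGroup E] [Module ℝ E]
    (A : E →ₗ[ℝ] E) : Submodule ℝ E :=
  realSpectralSubspace A {μ : ℂ | μ.re ≤ 0}

/-- The unstable subspace of `A`: eigenvalues with `0 < Re μ`. -/
noncomputable def unstableSubspace {E : Type*} [AddCommGroup E] [Module ℝ E]
    (A : E →ₗ[ℝ] E) : Submodule ℝ E :=
  realSpectralSubspace A {μ : ℂ | 0 < μ.re}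

/-- `M` is a local center stable manifold of class `C^k` for the autonomous equation `u' = f u`
at `p`, with `A = df(p)`. -/
def IsLocalCenterStableManifold {E : Type*} [NormedAddCommGroup E] [NormedSpace ℝ E]
    (k : ℕ) (f : E → E) (p : E) (M : Set E) : Prop :=
  ∃ U : Set E, IsOpen U ∧ p ∈ U ∧
    -- inside `U`, and in the coordinate `w = u - p`, `M` is the graph of a `C^k` map `φ` from
    -- the center stable subspace to the unstable subspace, tangent at `p` to the former
    (∃ φ : centerStableSubspace (fderiv ℝ f p : E →ₗ[ℝ] E) →
        unstableSubspace (fderiv ℝ f p : E →ₗ[ℝ] E),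
      ContDiff ℝ k φ ∧ φ 0 = 0 ∧ HasFDerivAt φ
        (0 : centerStableSubspace (fderiv ℝ f p : E →ₗ[ℝ] E) →L[ℝ]
          unstableSubspace (fderiv ℝ f p : E →ₗ[ℝ] E)) 0 ∧
      M = {u | u ∈ U ∧ ∃ v : centerStableSubspace (fderiv ℝ f p : E →ₗ[ℝ] E),
        u - p = (v : E) + (φ v : E)}) ∧
    -- local invariance, in both time directions: on a time interval on which it stays in `U`,
    -- a solution that meets `M` lies in `M`
    (∀ (I : Set ℝ) (u : ℝ → E), I.OrdConnected → IsIntegralCurveOn u (fun _ => f) I →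
      (∀ t ∈ I, u t ∈ U) → (∃ t ∈ I, u t ∈ M) → ∀ t ∈ I, u t ∈ M) ∧
    -- every solution that stays sufficiently close to `p` in forward time lies in `M`
    (∃ δ : ℝ, 0 < δ ∧ ∀ u : ℝ → E, IsIntegralCurveOn u (fun _ => f) (Set.Ici 0) →
      (∀ t, 0 ≤ t → ‖u t - p‖ < δ) → ∀ t, 0 ≤ t → u t ∈ M)

open MeasureTheory Filter

/-! Existence is the Lyapunov–Perron method. Move the equilibrium to the origin and split the field
as `A` plus a second-order remainder; `exists_cutoff` replaces the remainder by a global `g`, equal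
to it near 0, with bounded derivatives up to order `k + 1` and `‖Dg‖` as small as desired. The
spectral splitting yields an exponential dichotomy (`exists_isExpDichotomy`): growth slower than
every positive rate on the center stable subspace, and backward decay at a fixed rate `b > 0` on the
unstable one.

For a small rate `η`, a forward solution of `u' = A u + g u` grows at most like `exp (η t)` exactly
when it solves `y t = T t v + ∫ Γ t s (g (y s)) ds` with `v = P (y 0)`: its unstable part is
determined by its whole future. This equation is a contraction in the weight `exp (η t)`, so the
initial values of slowly growing solutions form a graph over the center stable subspace
(`IsExpDichotomy.exists_global_centerStable`). Slow growth depends only on the far future, which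
gives local invariance in both time directions, and solutions staying near the equilibrium are
bounded, hence slow.

For smoothness no fiber contraction is used. The `j`-th `v`-derivative of a Picard iterate grows
like `exp (j η t)`, and the kernel obeys one and the same bound at all rates from `η` to `(k + 1)
η`. The highest derivative is therefore always multiplied by the same contraction factor, and the
bounds are uniform in the iterate (`IsLyapunovPerronSystem.picardIterate_regular`). Uniform
convergence together with uniform bounds up to order `k + 1` gives a `C^k` limit
(`contDiff_of_tendstoUniformly_of_iteratedFDeriv_le`); this is where one derivative is lost.

Nonuniqueness comes from `x' = x ^ 2`, `y' = y`: each curve `y = c * exp (-1 / x)` for `x > 0`,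
continued by `y = 0`, is a center stable manifold. -/

/-! ### Interpolation, and limits of functions with bounded derivatives -/

/-- Landau-type interpolation: over a step of length `r` the increment is at most `2 e` and differs
from its linear part by at most `B r ^ 2`; divide by `r`. -/
theorem norm_fderiv_le_of_norm_le_of_lipschitz {V F : Type*} [NormedAddCommGroup V] [NormedSpace ℝ V]
    [NormedAddCommGroup F] [NormedSpace ℝ F] {h : V → F} {h' : V → V →L[ℝ] F}
    (hd : ∀ x, HasFDerivAt h (h' x) x) {e B r : ℝ} (hB0 : 0 ≤ B)
    (hr : 0 < r) (he : ∀ x, ‖h x‖ ≤ e)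
    (hB : ∀ x y, ‖h' x - h' y‖ ≤ B * ‖x - y‖) (v : V) : ‖h' v‖ ≤ 2 * e / r + B * r := by
  have he0 : 0 ≤ e := (norm_nonneg _).trans (he v)
  have key : ∀ w : V, ‖w‖ = r → ‖h' v w‖ ≤ (2 * e / r + B * r) * r := by
    intro w hw
    have := (convex_closedBall v r).norm_image_sub_le_of_norm_hasFDerivWithin_le' (f := h)
      (f' := h') (φ := h' v) (C := B * r) (fun x _ => (hd x).hasFDerivWithinAt)
      (fun x hx => (hB x v).trans (by
        gcongr; rwa [Metric.mem_closedBall, dist_eq_norm] at hx))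
      (x := v) (y := v + w) (by simp [hr.le]) (by simp [hw])
    rw [add_sub_cancel_left, hw] at this
    have h1 := he (v + w)
    have h2 := he v
    have h3 : ‖h' v w‖ ≤ ‖h (v + w) - h v - h' v w‖ + ‖h (v + w) - h v‖ := by
      have := norm_sub_le (h (v + w) - h v) (h (v + w) - h v - h' v w)
      rw [sub_sub_cancel] at this
      linarith
    have h4 := norm_sub_le (h (v + w)) (h v)
    have h5 : (2 * e / r + B * r) * r = 2 * e + B * r * r := by field_simp
    linarith
  rcases subsingleton_or_nontrivial V with hV | hV
  · have : h' v = 0 := by ext w; simp [Subsingleton.elim w 0]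
    rw [this, norm_zero]; positivity
  · obtain ⟨w, hw⟩ := exists_norm_eq V hr.le
    refine ContinuousLinearMap.opNorm_le_bound _ ?_ fun w => ?_
    · have := (norm_nonneg _).trans (key w hw)
      exact nonneg_of_mul_nonneg_left this hr
    · rcases eq_or_ne w 0 with rfl | hw0
      · simp
      have hn : 0 < ‖w‖ := norm_pos_iff.2 hw0
      have := key ((r / ‖w‖) • w) (by rw [norm_smul, Real.norm_of_nonneg (by positivity)]; field_simp)
      rw [map_smul, norm_smul, Real.norm_of_nonneg (by positivity)] at this
      have h2 : r / ‖w‖ * ‖h' v w‖ = (‖h' v w‖ / ‖w‖) * r := by ring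
      rw [h2] at this
      have := le_of_mul_le_mul_right this hr
      rwa [div_le_iff₀ hn] at this

/-- The second-derivative bound makes the first derivatives equi-Lipschitz, so interpolation turns
uniform convergence of the functions into uniform convergence of their derivatives; then induct on
the derivative. The target space varies in the induction, as it becomes a space of linear maps. -/
theorem contDiff_of_tendstoUniformly_of_iteratedFDeriv_le {V : Type u} [NormedAddCommGroup V]
    [NormedSpace ℝ V] {B : ℝ} (k : ℕ) : ∀ {F : Type u} [NormedAddCommGroup F] [NormedSpace ℝ F]
    [CompleteSpace F] {f : ℕ → V → F} {g : V → F}, (∀ n, ContDiff ℝ (k + 1 : ℕ) (f n)) →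
    (∀ n j v, 1 ≤ j → j ≤ k + 1 → ‖iteratedFDeriv ℝ j (f n) v‖ ≤ B) →
    TendstoUniformly f g atTop → ContDiff ℝ k g := by
  induction k with
  | zero =>
    intro F _ _ _ f g hf hB hlim
    rw [Nat.cast_zero, contDiff_zero]
    exact hlim.continuous (Frequently.of_forall fun n => (hf n).continuous)
  | succ k ih =>
    intro F _ _ _ f g hf hB hlim
    have hd : ∀ n x, HasFDerivAt (f n) (fderiv ℝ (f n) x) x := fun n x =>
      ((hf n).differentiable (by simp) x).hasFDerivAt
    have hf' : ∀ n, ContDiff ℝ (k + 1 : ℕ) (fderiv ℝ (f n)) := fun n =>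
      (hf n).fderiv_right (by norm_cast)
    have hlip : ∀ n x y, ‖fderiv ℝ (f n) x - fderiv ℝ (f n) y‖ ≤ B * ‖x - y‖ := by
      intro n x y
      refine convex_univ.norm_image_sub_le_of_norm_fderiv_le (𝕜 := ℝ) (f := fderiv ℝ (f n))
        (fun z _ => (hf' n).differentiable (by simp) z) (fun z _ => ?_) trivial trivial
      have := hB n 2 z (by norm_num) (by omega)
      rw [← norm_iteratedFDeriv_fderiv, ← norm_iteratedFDeriv_fderiv, norm_iteratedFDeriv_zero]
        at this
      exact this
    have hB0 : 0 ≤ B := (norm_nonneg _).trans (hB 0 1 0 le_rfl (by omega))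
    have hcau : UniformCauchySeqOn (fun n => fderiv ℝ (f n)) atTop Set.univ := by
      rw [Metric.uniformCauchySeqOn_iff]
      intro e he
      have hc := hlim.tendstoUniformlyOn (s := Set.univ) |>.uniformCauchySeqOn
      rw [Metric.uniformCauchySeqOn_iff] at hc
      -- With this radius and closeness `r * e / 8`, the two interpolation terms are at most `e / 4`
      -- and `e / 2`.
      set r := e / (4 * B + 1) with hr
      have hr0 : 0 < r := by positivity
      obtain ⟨M, hM⟩ := hc (r * e / 8) (by positivity)
      refine ⟨M, fun m hm n hn x _ => ?_⟩
      have := norm_fderiv_le_of_norm_le_of_lipschitz (h := fun x => f m x - f n x)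
        (h' := fun x => fderiv ℝ (f m) x - fderiv ℝ (f n) x) (fun x => (hd m x).sub (hd n x))
        (e := r * e / 8) (B := 2 * B) (by positivity) hr0 (fun x => by
          rw [← dist_eq_norm]; exact (hM m hm n hn x trivial).le)
        (fun x y => by
          have h1 := hlip m x y
          have h2 := hlip n x y
          rw [sub_sub_sub_comm]
          refine (norm_sub_le _ _).trans ?_
          linarith) x
      rw [dist_eq_norm]
      refine this.trans_lt ?_
      have h1 : 2 * (r * e / 8) / r = e / 4 := by field_simp; norm_num
      have h2 : 2 * B * r ≤ e / 2 := by
        rw [hr, mul_div_assoc', div_le_iff₀ (by positivity)]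
        nlinarith
      linarith
    have hex : ∀ x, ∃ G, Tendsto (fun n => fderiv ℝ (f n) x) atTop (𝓝 G) := fun x =>
      cauchySeq_tendsto_of_complete (hcau.cauchySeq (Set.mem_univ x))
    choose G hG using hex
    have hunif : TendstoUniformly (fun n => fderiv ℝ (f n)) G atTop := by
      rw [← tendstoUniformlyOn_univ]
      exact hcau.tendstoUniformlyOn_of_tendsto fun x _ => hG x
    push_cast
    refine contDiff_succ_iff_hasFDerivAt.2 ⟨G, ?_, fun x =>
      hasFDerivAt_of_tendstoUniformly hunif hd (fun y => hlim.tendsto_at y) x⟩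
    exact ih hf' (fun n j v h1 h2 => by
      rw [norm_iteratedFDeriv_fderiv]; exact hB n (j + 1) v (by omega) (by omega)) hunif

/-! ### Derivatives of integrals and of compositions -/

theorem hasFTaylorSeriesUpTo_integral {α V F : Type*} [MeasurableSpace α] {μ : Measure α}
    [NormedAddCommGroup V] [NormedSpace ℝ V] [NormedAddCommGroup F] [NormedSpace ℝ F]
    [CompleteSpace F] {N : ℕ} {H : α → V → F} {b : ℕ → α → ℝ}
    (hH : ∀ᵐ s ∂μ, ContDiff ℝ N (H s))
    (hm : ∀ j ≤ N, ∀ v, AEStronglyMeasurable (fun s => iteratedFDeriv ℝ j (H s) v) μ)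
    (hb : ∀ j ≤ N, Integrable (b j) μ)
    (hle : ∀ j ≤ N, ∀ᵐ s ∂μ, ∀ v, ‖iteratedFDeriv ℝ j (H s) v‖ ≤ b j s) :
    HasFTaylorSeriesUpTo N (fun v => ∫ s, H s v ∂μ)
      (fun v j => ∫ s, iteratedFDeriv ℝ j (H s) v ∂μ) := by
  have hint : ∀ j ≤ N, ∀ v, Integrable (fun s => iteratedFDeriv ℝ j (H s) v) μ := fun j hj v =>
    (hb j hj).mono' (hm j hj v) ((hle j hj).mono fun s hs => hs v)
  constructor
  · intro v
    have : (fun s => H s v) =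
        fun s => continuousMultilinearCurryFin0 ℝ V F (iteratedFDeriv ℝ 0 (H s) v) := by
      ext s; simp
    rw [this]
    exact ((continuousMultilinearCurryFin0 ℝ V F).toContinuousLinearEquiv.integral_comp_comm _).symm
  · intro m hmN v
    have hmN : m < N := by exact_mod_cast hmN
    have hc : (∫ s, iteratedFDeriv ℝ m.succ (H s) v ∂μ).curryLeft =
        ∫ s, (iteratedFDeriv ℝ m.succ (H s) v).curryLeft ∂μ := by
      let e : (V [×(m + 1)]→L[ℝ] F) →L[ℝ] (V →L[ℝ] (V [×m]→L[ℝ] F)) :=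
        ((continuousMultilinearCurryLeftEquiv ℝ (fun _ : Fin (m + 1) => V)
          F).toContinuousLinearEquiv.toContinuousLinearMap)
      exact (ContinuousLinearMap.integral_comp_comm (𝕜 := ℝ) (Fₗ := V →L[ℝ] (V [×m]→L[ℝ] F)) e
        (hint (m + 1) hmN v)).symm
    rw [hc]
    refine hasFDerivAt_integral_of_dominated_of_fderiv_le (s := Set.univ) (bound := b (m + 1))
      (F' := fun x s => (iteratedFDeriv ℝ m.succ (H s) x).curryLeft)
      univ_mem (Eventually.of_forall fun x => hm m hmN.le x) (hint m hmN.le v)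
      ((continuousMultilinearCurryLeftEquiv ℝ (fun _ : Fin (m + 1) => V)
        F).continuous.comp_aestronglyMeasurable (hm (m + 1) hmN v)) ?_ (hb (m + 1) hmN) ?_
    · filter_upwards [hle (m + 1) hmN] with s hs x _
      rw [ContinuousMultilinearMap.curryLeft_norm]
      exact hs x
    · filter_upwards [hH] with s hs x _
      exact hs.ftaylorSeries.fderiv m (by exact_mod_cast hmN) x
  · intro m hmN
    have hmN : m ≤ N := by exact_mod_cast hmN
    refine continuous_of_dominated (bound := b m) (fun x => hm m hmN x) (fun x => ?_) (hb m hmN) ?_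
    · filter_upwards [hle m hmN] with s hs using hs x
    · filter_upwards [hH] with s hs
      exact hs.ftaylorSeries.cont m (by exact_mod_cast hmN)

/-- Apply the Leibniz rule to `Dg(y) ∘ Dy`. The only term containing the top derivative of `y`
carries `‖Dg‖ ≤ e`, the constant that can be made small; all other terms involve lower derivatives
only. -/
theorem norm_iteratedFDeriv_succ_comp_le_of_norm_fderiv_le {V E F : Type*} [NormedAddCommGroup V]
    [NormedSpace ℝ V] [NormedAddCommGroup E] [NormedSpace ℝ E] [NormedAddCommGroup F]
    [NormedSpace ℝ F] {g : E → F} {y : V → E} {N j : ℕ} (hg : ContDiff ℝ N g)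
    (hy : ContDiff ℝ N y) (hj : j + 1 ≤ N) (x : V) {G e D : ℝ}
    (hG : ∀ i ≤ N, ∀ z, ‖iteratedFDeriv ℝ i g z‖ ≤ G) (he : ∀ z, ‖fderiv ℝ g z‖ ≤ e)
    (hD : ∀ i, 1 ≤ i → i ≤ j → ‖iteratedFDeriv ℝ i y x‖ ≤ D ^ i) :
    ‖iteratedFDeriv ℝ (j + 1) (g ∘ y) x‖ ≤ e * ‖iteratedFDeriv ℝ (j + 1) y x‖ +
      (∑ i ∈ Finset.range j, (j.choose (i + 1) * (i + 1).factorial : ℝ)) * G * D ^ (j + 1) := by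
  have hNj : (j + 1 : ℕ) ≤ (N : WithTop ℕ∞) := by exact_mod_cast hj
  have hg1 : ContDiff ℝ j (fderiv ℝ g) := hg.fderiv_right (by exact_mod_cast hNj)
  have hy1 : ContDiff ℝ j (fderiv ℝ y) := hy.fderiv_right (by exact_mod_cast hNj)
  have hyj : ContDiff ℝ j y := hy.of_le (by exact_mod_cast (by omega : j ≤ N))
  have hN0 : (N : WithTop ℕ∞) ≠ 0 := by
    have : N ≠ 0 := by omega
    exact_mod_cast this
  have hfd : fderiv ℝ (g ∘ y) =
      fun v => ContinuousLinearMap.compL ℝ V E F ((fderiv ℝ g ∘ y) v) (fderiv ℝ y v) := by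
    ext1 v
    exact fderiv_comp v (hg.differentiable hN0 _) (hy.differentiable hN0 _)
  rw [← norm_iteratedFDeriv_fderiv, hfd]
  refine ((ContinuousLinearMap.compL ℝ V E F).norm_iteratedFDeriv_le_of_bilinear_of_le_one
    (hg1.comp hyj) hy1 x le_rfl (ContinuousLinearMap.norm_compL_le ℝ V E F)).trans ?_
  rw [Finset.sum_range_succ', add_comm]
  refine add_le_add ?_ ?_
  · simp only [Nat.choose_zero_right, Nat.cast_one, one_mul, norm_iteratedFDeriv_zero,
      norm_iteratedFDeriv_fderiv, Function.comp_apply]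
    exact mul_le_mul_of_nonneg_right (he _) (norm_nonneg _)
  · rw [Finset.sum_mul, Finset.sum_mul]
    refine Finset.sum_le_sum fun i hi => ?_
    rw [Finset.mem_range] at hi
    have h1 : ‖iteratedFDeriv ℝ (i + 1) (fderiv ℝ g ∘ y) x‖ ≤
        (i + 1).factorial * G * D ^ (i + 1) :=
      norm_iteratedFDeriv_comp_le hg1 hyj (by exact_mod_cast hi) x
        (fun l hl => by rw [norm_iteratedFDeriv_fderiv]; exact hG _ (by omega) _)
        (fun l hl hl' => hD l hl (by omega))
    have h2 : ‖iteratedFDeriv ℝ (j - (i + 1)) (fderiv ℝ y) x‖ ≤ D ^ (j - i) := by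
      rw [norm_iteratedFDeriv_fderiv]
      have : j - (i + 1) + 1 = j - i := by omega
      rw [this]
      exact hD _ (by omega) (by omega)
    have h3 : D ^ (j + 1) = D ^ (i + 1) * D ^ (j - i) := by
      rw [← pow_add]; congr 1; omega
    calc _ ≤ j.choose (i + 1) * ((i + 1).factorial * G * D ^ (i + 1)) * D ^ (j - i) := by
          refine mul_le_mul (mul_le_mul_of_nonneg_left h1 (by positivity)) h2 (norm_nonneg _) ?_
          exact mul_nonneg (by positivity) ((norm_nonneg _).trans h1)
      _ = _ := by rw [h3]; ring

/-- By the Faà di Bruno formula the derivative is a finite sum of continuous expressions in the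
derivatives of `g` and `y t`. -/
theorem continuous_iteratedFDeriv_comp {T V E F : Type*} [TopologicalSpace T]
    [NormedAddCommGroup V] [NormedSpace ℝ V] [NormedAddCommGroup E] [NormedSpace ℝ E]
    [NormedAddCommGroup F] [NormedSpace ℝ F] {g : E → F} {y : T → V → E} {N j : ℕ}
    (hg : ContDiff ℝ N g) (hy : ∀ t, ContDiff ℝ N (y t)) (hj : j ≤ N) (v : V)
    (hc : ∀ i ≤ j, Continuous fun t => iteratedFDeriv ℝ i (y t) v) :
    Continuous fun t => iteratedFDeriv ℝ j (g ∘ y t) v := by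
  have hyc : Continuous fun t => y t v := by
    have := (continuousMultilinearCurryFin0 ℝ V E).continuous.comp (hc 0 (Nat.zero_le _))
    convert this using 2 with t
    simp
  have h : ∀ t, iteratedFDeriv ℝ j (g ∘ y t) v =
      (ftaylorSeries ℝ g (y t v)).taylorComp (ftaylorSeries ℝ (y t) v) j := fun t =>
    iteratedFDeriv_comp hg.contDiffAt (hy t).contDiffAt (by exact_mod_cast hj)
  simp only [h, FormalMultilinearSeries.taylorComp]
  refine continuous_finsetSum _ fun c _ => ?_
  have hB : Continuous fun t => c.compAlongOrderedFinpartitionL ℝ V E F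
      (iteratedFDeriv ℝ c.length g (y t v)) :=
    (c.compAlongOrderedFinpartitionL ℝ V E F).continuous.comp
      ((hg.continuous_iteratedFDeriv (by exact_mod_cast c.length_le.trans hj)).comp hyc)
  have hp : Continuous fun t => fun m : Fin c.length => iteratedFDeriv ℝ (c.partSize m) (y t) v :=
    continuous_pi fun m => hc _ (c.partSize_le m)
  exact continuous_eval.comp (hB.prodMk hp)

theorem norm_iteratedFDeriv_id_le {V : Type*} [NormedAddCommGroup V] [NormedSpace ℝ V] (j : ℕ)
    (v : V) : ‖iteratedFDeriv ℝ (j + 1) (id : V → V) v‖ ≤ 1 := by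
  rw [← norm_iteratedFDeriv_fderiv]
  have : fderiv ℝ (id : V → V) = fun _ => ContinuousLinearMap.id ℝ V := by
    ext1 x; exact fderiv_id
  rw [this]
  rcases Nat.eq_zero_or_pos j with rfl | hj
  · rw [norm_iteratedFDeriv_zero]
    exact ContinuousLinearMap.norm_id_le
  · rw [iteratedFDeriv_const_of_ne hj.ne']; simp

/-! ### Exponential weights and dichotomy kernels -/

theorem integrable_exp_neg_mul_abs {δ : ℝ} (hδ : 0 < δ) :
    Integrable fun s : ℝ => Real.exp (-δ * |s|) := by
  rw [← integrableOn_univ, ← Set.Iic_union_Ioi (a := (0 : ℝ)), integrableOn_union]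
  constructor
  · refine (integrableOn_exp_mul_Iic hδ 0).congr_fun (fun s hs => ?_) measurableSet_Iic
    simp only [abs_of_nonpos (Set.mem_Iic.1 hs)]
    ring_nf
  · refine (integrableOn_exp_mul_Ioi (neg_lt_zero.2 hδ) 0).congr_fun (fun s hs => ?_)
      measurableSet_Ioi
    simp only [abs_of_pos (Set.mem_Ioi.1 hs)]

/-- Solvable because the unknown `B (j + 1)` enters with a coefficient `q < 1` and the rest depends
only on `B j`. The sequence supplies derivative bounds independent of the Picard iterate. -/
theorem exists_seq_recursive_bound {a q : ℝ} (hq : q < 1) (Q : ℕ → ℝ) :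
    ∃ B : ℕ → ℝ, (∀ j, 1 ≤ B j) ∧ Monotone B ∧
      ∀ j, a + q * B (j + 1) + Q j * B j ^ (j + 1) ≤ B (j + 1) := by
  let B : ℕ → ℝ := fun j => Nat.rec 1 (fun j b => max b ((a + Q j * b ^ (j + 1)) / (1 - q))) j
  have hB : ∀ j, B (j + 1) = max (B j) ((a + Q j * B j ^ (j + 1)) / (1 - q)) := fun j => rfl
  have hmono : Monotone B := monotone_nat_of_le_succ fun j => by rw [hB]; exact le_max_left _ _
  refine ⟨B, fun j => hmono (Nat.zero_le j), hmono, fun j => ?_⟩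
  have h : (a + Q j * B j ^ (j + 1)) / (1 - q) ≤ B (j + 1) := by rw [hB j]; exact le_max_right _ _
  rw [div_le_iff₀ (by linarith)] at h
  linarith

/-- A Green kernel of a hyperbolic splitting: it decays exponentially away from the diagonal with
respect to every exponential weight whose rate lies in `[η, R]`. -/
structure IsDichotomyKernel {E : Type*} [NormedAddCommGroup E] [NormedSpace ℝ E]
    (Γ : ℝ → ℝ → E →L[ℝ] E) (C δ η R : ℝ) : Prop where
  const_nonneg : 0 ≤ C
  delta_pos : 0 < δ
  meas : ∀ t, AEStronglyMeasurable (Γ t) (volume.restrict (Set.Ioi 0))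
  cont : ∀ s t, t ≠ s → ContinuousAt (fun t => Γ t s) t
  bound : ∀ r, η ≤ r → r ≤ R → ∀ t s,
    ‖Γ t s‖ ≤ C * Real.exp (r * (t - s)) * Real.exp (-δ * |t - s|)

namespace IsDichotomyKernel

variable {E X : Type*} [NormedAddCommGroup E] [NormedSpace ℝ E] [NormedAddCommGroup X]
  {Γ : ℝ → ℝ → E →L[ℝ] E} {C δ η R : ℝ}

theorem mul_exp_le (h : IsDichotomyKernel Γ C δ η R) {r M : ℝ} (hr : η ≤ r) (hr' : r ≤ R)
    (hM : 0 ≤ M) (t s : ℝ) :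
    ‖Γ t s‖ * (M * Real.exp (r * s)) ≤ M * C * Real.exp (r * t) * Real.exp (-δ * |t - s|) := by
  have h1 := mul_le_mul_of_nonneg_right (h.bound r hr hr' t s)
    (by positivity : 0 ≤ M * Real.exp (r * s))
  refine h1.trans (le_of_eq ?_)
  have : Real.exp (r * t) = Real.exp (r * (t - s)) * Real.exp (r * s) := by
    rw [← Real.exp_add]; ring_nf
  rw [this]; ring

theorem integrable_bound (h : IsDichotomyKernel Γ C δ η R) (a t : ℝ) :
    Integrable (fun s => a * Real.exp (-δ * |t - s|)) :=
  ((integrable_exp_neg_mul_abs h.delta_pos).comp_sub_left t).const_mul a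

theorem integrable (h : IsDichotomyKernel Γ C δ η R) {r M : ℝ} (hr : η ≤ r) (hr' : r ≤ R)
    (hM : 0 ≤ M) {t : ℝ} {w : ℝ → X}
    (hm : AEStronglyMeasurable w (volume.restrict (Set.Ioi 0)))
    (hw : ∀ s, 0 < s → ‖w s‖ ≤ ‖Γ t s‖ * (M * Real.exp (r * s))) :
    IntegrableOn w (Set.Ioi 0) := by
  refine (h.integrable_bound (M * C * Real.exp (r * t)) t).integrableOn.mono' hm ?_
  filter_upwards [ae_restrict_mem measurableSet_Ioi] with s hs
  exact (hw s hs).trans (h.mul_exp_le hr hr' hM t s)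

/-- The constant is the same for every rate `r` in `[η, R]`, so one smallness condition serves the
derivatives of all orders. -/
theorem norm_integral_le [NormedSpace ℝ X] (h : IsDichotomyKernel Γ C δ η R) {r M : ℝ}
    (hr : η ≤ r) (hr' : r ≤ R)
    (hM : 0 ≤ M) {t : ℝ} {w : ℝ → X}
    (hw : ∀ s, 0 < s → ‖w s‖ ≤ ‖Γ t s‖ * (M * Real.exp (r * s))) :
    ‖∫ s in Set.Ioi 0, w s‖ ≤
      C * (∫ s : ℝ, Real.exp (-δ * |s|)) * M * Real.exp (r * t) := by
  have hI := h.integrable_bound (M * C * Real.exp (r * t)) t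
  have h1 : ‖∫ s in Set.Ioi 0, w s‖ ≤
      ∫ s in Set.Ioi 0, M * C * Real.exp (r * t) * Real.exp (-δ * |t - s|) := by
    refine norm_integral_le_of_norm_le hI.integrableOn ?_
    filter_upwards [ae_restrict_mem measurableSet_Ioi] with s hs
    exact (hw s hs).trans (h.mul_exp_le hr hr' hM t s)
  have hC := h.const_nonneg
  refine h1.trans ((setIntegral_le_integral hI
    (Eventually.of_forall fun s => by positivity)).trans (le_of_eq ?_))
  rw [integral_const_mul, integral_sub_left_eq_self (fun s : ℝ => Real.exp (-δ * |s|))]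
  ring

/-- The kernel may jump on the diagonal, but for fixed `t₀` this concerns only the null set `s =
t₀`; dominated convergence does the rest. -/
theorem continuous_integral [NormedSpace ℝ X] (h : IsDichotomyKernel Γ C δ η R) {r M : ℝ}
    (hr : η ≤ r) (hr' : r ≤ R)
    (hr0 : 0 ≤ r) (hM : 0 ≤ M) {w : ℝ → ℝ → X}
    (hm : ∀ t, AEStronglyMeasurable (w t) (volume.restrict (Set.Ioi 0)))
    (hc : ∀ s t, t ≠ s → ContinuousAt (fun t => w t s) t)
    (hw : ∀ t s, 0 < s → ‖w t s‖ ≤ ‖Γ t s‖ * (M * Real.exp (r * s))) :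
    Continuous fun t => ∫ s in Set.Ioi 0, w t s := by
  rw [continuous_iff_continuousAt]
  intro t₀
  have hC := h.const_nonneg
  have hδ := h.delta_pos
  refine continuousAt_of_dominated
    (bound := fun s => (M * C * Real.exp (r * (t₀ + 1)) * Real.exp δ) * Real.exp (-δ * |t₀ - s|))
    (Eventually.of_forall hm) ?_ (h.integrable_bound _ _).integrableOn ?_
  · filter_upwards [Metric.ball_mem_nhds t₀ one_pos] with t ht
    rw [Metric.mem_ball, Real.dist_eq] at ht
    filter_upwards [ae_restrict_mem measurableSet_Ioi] with s hs
    refine (hw t s hs).trans ((h.mul_exp_le hr hr' hM t s).trans ?_)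
    rw [mul_assoc _ (Real.exp δ), ← Real.exp_add]
    have h2 : |t₀ - s| ≤ |t - t₀| + |t - s| := by
      rw [abs_sub_comm t t₀]; exact abs_sub_le _ _ _
    have h3 := abs_lt.1 ht
    gcongr
    · linarith
    · nlinarith
  · have : ∀ᵐ s ∂(volume.restrict (Set.Ioi (0 : ℝ))), s ≠ t₀ :=
      ae_restrict_of_ae (Measure.ae_ne volume t₀)
    filter_upwards [this] with s hs
    exact hc s t₀ hs.symm

theorem norm_integral_sub_le (h : IsDichotomyKernel Γ C δ η R) (hηR : η ≤ R)
    {g : E → E} {G e : ℝ} (hgc : Continuous g) (hη : 0 ≤ η)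
    (hG : ∀ x, ‖g x‖ ≤ G) (he : ∀ x y, ‖g x - g y‖ ≤ e * ‖x - y‖) (he0 : 0 ≤ e) {z₁ z₂ : ℝ → E}
    (h₁ : ContinuousOn z₁ (Set.Ici 0)) (h₂ : ContinuousOn z₂ (Set.Ici 0)) {M : ℝ}
    (hM : ∀ s, 0 ≤ s → ‖z₁ s - z₂ s‖ ≤ M * Real.exp (η * s)) (t : ℝ) :
    ‖(∫ s in Set.Ioi 0, Γ t s (g (z₁ s))) - ∫ s in Set.Ioi 0, Γ t s (g (z₂ s))‖ ≤
      (C * (∫ s : ℝ, Real.exp (-δ * |s|))) * e * M * Real.exp (η * t) := by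
  have hG0 : 0 ≤ G := (norm_nonneg _).trans (hG 0)
  have hM0 : 0 ≤ M := by simpa using (norm_nonneg _).trans (hM 0 le_rfl)
  have hI : ∀ z : ℝ → E, ContinuousOn z (Set.Ici 0) →
      IntegrableOn (fun s => Γ t s (g (z s))) (Set.Ioi 0) := by
    intro z hz
    have hz' : AEStronglyMeasurable (fun s => g (z s)) (volume.restrict (Set.Ioi 0)) :=
      (hgc.comp_continuousOn (hz.mono Set.Ioi_subset_Ici_self)).aestronglyMeasurable
        measurableSet_Ioi
    refine h.integrable (t := t) (r := η) (M := G) le_rfl hηR hG0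
      (isBoundedBilinearMap_apply.continuous.comp_aestronglyMeasurable ((h.meas t).prodMk hz'))
      fun s hs => ?_
    refine (ContinuousLinearMap.le_opNorm _ _).trans ?_
    gcongr
    have : 1 ≤ Real.exp (η * s) := Real.one_le_exp (by positivity)
    nlinarith [hG (z s)]
  rw [← integral_sub (hI z₁ h₁) (hI z₂ h₂), mul_assoc _ e M]
  refine h.norm_integral_le le_rfl hηR (by positivity) fun s hs => ?_
  rw [← map_sub]
  refine (ContinuousLinearMap.le_opNorm _ _).trans ?_
  gcongr
  rw [mul_assoc]
  exact (he _ _).trans (mul_le_mul_of_nonneg_left (hM s hs.le) he0)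

end IsDichotomyKernel

/-! ### The Lyapunov–Perron equation and the regularity of its Picard iterates -/

/-- The Picard iterates of the Lyapunov–Perron equation `y t v = S t v + ∫ Γ t s (g (y s v)) ds`. -/
noncomputable def picardIterate {V E : Type*} [NormedAddCommGroup V] [NormedSpace ℝ V]
    [NormedAddCommGroup E] [NormedSpace ℝ E] (S : ℝ → V →L[ℝ] E) (Γ : ℝ → ℝ → E →L[ℝ] E)
    (g : E → E) : ℕ → ℝ → V → E
  | 0 => fun t v => S t v
  | n + 1 => fun t v => S t v + ∫ s in Set.Ioi 0, Γ t s (g (picardIterate S Γ g n s v))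

/-- The data of a Lyapunov–Perron equation `y t v = S t v + ∫ Γ t s (g (y s v)) ds` which is a
contraction in the space of functions of exponential growth rate `η`, and which is regular enough
for its solution to be differentiated `N - 1` times in `v`. -/
structure IsLyapunovPerronSystem {V E : Type*} [NormedAddCommGroup V] [NormedSpace ℝ V]
    [NormedAddCommGroup E] [NormedSpace ℝ E] (N : ℕ) (S : ℝ → V →L[ℝ] E)
    (Γ : ℝ → ℝ → E →L[ℝ] E) (g : E → E) (C δ η R a G e : ℝ) : Prop where
  kernel : IsDichotomyKernel Γ C δ η R
  eta_pos : 0 < η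
  one_le : 1 ≤ N
  rate : N * η ≤ R
  continuous_linear : Continuous S
  norm_linear_le : ∀ t, 0 ≤ t → ‖S t‖ ≤ a * Real.exp (η * t)
  contDiff : ContDiff ℝ N g
  norm_iteratedFDeriv_le : ∀ i ≤ N, ∀ z, ‖iteratedFDeriv ℝ i g z‖ ≤ G
  norm_fderiv_le : ∀ z, ‖fderiv ℝ g z‖ ≤ e
  small : C * (∫ s : ℝ, Real.exp (-δ * |s|)) * e < 1
  map_zero : g 0 = 0

namespace IsLyapunovPerronSystem

variable {V E : Type*} [NormedAddCommGroup V] [NormedSpace ℝ V]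
    [NormedAddCommGroup E] [NormedSpace ℝ E] {N : ℕ} {S : ℝ → V →L[ℝ] E}
    {Γ : ℝ → ℝ → E →L[ℝ] E} {g : E → E} {C δ η R a G e : ℝ}

theorem lip_nonneg (h : IsLyapunovPerronSystem N S Γ g C δ η R a G e) : 0 ≤ e :=
  (norm_nonneg _).trans (h.norm_fderiv_le 0)

theorem rate_le (h : IsLyapunovPerronSystem N S Γ g C δ η R a G e) {j : ℕ} (hj : j ≤ N) :
    j * η ≤ R :=
  (mul_le_mul_of_nonneg_right (by exact_mod_cast hj) h.eta_pos.le).trans h.rate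

theorem eta_le (h : IsLyapunovPerronSystem N S Γ g C δ η R a G e) : η ≤ R := by
  simpa using h.rate_le h.one_le

theorem bound_nonneg (h : IsLyapunovPerronSystem N S Γ g C δ η R a G e) : 0 ≤ G :=
  (norm_nonneg _).trans (h.norm_iteratedFDeriv_le 0 (Nat.zero_le _) 0)

theorem norm_le (h : IsLyapunovPerronSystem N S Γ g C δ η R a G e) (x : E) : ‖g x‖ ≤ G := by
  simpa using h.norm_iteratedFDeriv_le 0 (Nat.zero_le _) x

theorem factor_nonneg (h : IsLyapunovPerronSystem N S Γ g C δ η R a G e) :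
    0 ≤ C * (∫ s : ℝ, Real.exp (-δ * |s|)) :=
  mul_nonneg h.kernel.const_nonneg (integral_nonneg fun _ => (Real.exp_pos _).le)

theorem norm_sub_le (h : IsLyapunovPerronSystem N S Γ g C δ η R a G e) (x y : E) :
    ‖g x - g y‖ ≤ e * ‖x - y‖ :=
  convex_univ.norm_image_sub_le_of_norm_fderiv_le (𝕜 := ℝ)
    (fun z _ => h.contDiff.differentiable
      (by have := h.one_le; exact_mod_cast (by omega : N ≠ 0)) z)
    (fun z _ => h.norm_fderiv_le z) trivial trivial

theorem iteratedFDeriv_linear (L : V →L[ℝ] E) (j : ℕ) (v : V) :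
    iteratedFDeriv ℝ j L v = L.compContinuousMultilinearMap (iteratedFDeriv ℝ j id v) :=
  L.iteratedFDeriv_comp_left (contDiff_id (n := j)).contDiffAt le_rfl

/-- Differentiating under the integral, the derivative of order `j + 1` of the next iterate is
bounded by the linear part, a contraction factor times the same derivative of the current iterate,
and lower-order terms. The recursive choice of `B` closes the induction on `n`. -/
theorem picardIterate_regular [CompleteSpace E]
    (h : IsLyapunovPerronSystem N S Γ g C δ η R a G e) :
    ∃ B : ℕ → ℝ, (∀ j, 1 ≤ B j) ∧ ∀ n, (∀ t, ContDiff ℝ N (picardIterate S Γ g n t)) ∧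
      (∀ j ≤ N, ∀ v, Continuous fun t => iteratedFDeriv ℝ j (picardIterate S Γ g n t) v) ∧
      ∀ j, j + 1 ≤ N → ∀ t, 0 ≤ t → ∀ v,
        ‖iteratedFDeriv ℝ (j + 1) (picardIterate S Γ g n t) v‖ ≤
          B (j + 1) * Real.exp ((j + 1 : ℕ) * η * t) := by
  set κ := C * (∫ s : ℝ, Real.exp (-δ * |s|)) with hκ
  have hκ0 : 0 ≤ κ := h.factor_nonneg
  have hη := h.eta_pos
  have he0 := h.lip_nonneg
  have hG0 := h.bound_nonneg
  obtain ⟨B, hB1, hBm, hB⟩ := exists_seq_recursive_bound (a := a) h.small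
    (fun j => κ * ((∑ i ∈ Finset.range j, (j.choose (i + 1) * (i + 1).factorial : ℝ)) * G))
  have hBpos : ∀ j, 0 < B j := fun j => one_pos.trans_le (hB1 j)
  have ha0 : 0 ≤ a := by simpa using (norm_nonneg _).trans (h.norm_linear_le 0 le_rfl)
  have hS : ∀ j t, 0 ≤ t → ∀ v, ‖iteratedFDeriv ℝ (j + 1) (S t) v‖ ≤
      a * Real.exp ((j + 1 : ℕ) * η * t) := by
    intro j t ht v
    rw [iteratedFDeriv_linear]
    refine ((S t).norm_compContinuousMultilinearMap_le _).trans ?_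
    have h1 := h.norm_linear_le t ht
    have h2 := norm_iteratedFDeriv_id_le j v
    have h3 : Real.exp (η * t) ≤ Real.exp ((j + 1 : ℕ) * η * t) := by
      gcongr
      push_cast
      nlinarith [mul_nonneg (Nat.cast_nonneg (α := ℝ) j) hη.le]
    calc _ ≤ (a * Real.exp (η * t)) * 1 := by gcongr
      _ ≤ _ := by rw [mul_one]; gcongr
  refine ⟨B, hB1, fun n => ?_⟩
  induction n with
  | zero =>
    refine ⟨fun t => (S t).contDiff, fun j _ v => ?_, fun j _ t ht v => ?_⟩
    · have : (fun t => iteratedFDeriv ℝ j (picardIterate S Γ g 0 t) v) = fun t =>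
          (S t).compContinuousMultilinearMap (iteratedFDeriv ℝ j id v) := by
        ext1 t; exact iteratedFDeriv_linear (S t) j v
      rw [this]
      exact isBoundedBilinearMap_compMultilinear.continuous.comp
        (h.continuous_linear.prodMk continuous_const)
    · refine (hS j t ht v).trans ?_
      gcongr
      have := hB j
      have h1 : 0 ≤ κ * e * B (j + 1) := by have := hBpos (j + 1); positivity
      have h2 : 0 ≤ κ * ((∑ i ∈ Finset.range j, (j.choose (i + 1) * (i + 1).factorial : ℝ)) * G)
        * B j ^ (j + 1) := by have := hBpos j; positivity
      linarith
  | succ n ih =>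
    obtain ⟨hCD, hCont, hBd⟩ := ih
    set Y := picardIterate S Γ g n with hY
    have hgY : ∀ s, ContDiff ℝ N (g ∘ Y s) := fun s => h.contDiff.comp (hCD s)
    have hgYc : ∀ j ≤ N, ∀ v, Continuous fun s => iteratedFDeriv ℝ j (g ∘ Y s) v :=
      fun j hj v => continuous_iteratedFDeriv_comp h.contDiff hCD hj v
        fun i hi => hCont i (hi.trans hj) v
    have hH : ∀ t s v j, j ≤ N → iteratedFDeriv ℝ j (fun v => Γ t s (g (Y s v))) v =
        (Γ t s).compContinuousMultilinearMap (iteratedFDeriv ℝ j (g ∘ Y s) v) :=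
      fun t s v j hj => (Γ t s).iteratedFDeriv_comp_left (hgY s).contDiffAt (by exact_mod_cast hj)
    have hkey : ∀ j, j + 1 ≤ N → ∀ s, 0 ≤ s → ∀ v, ‖iteratedFDeriv ℝ (j + 1) (g ∘ Y s) v‖ ≤
        (e * B (j + 1) + (∑ i ∈ Finset.range j, (j.choose (i + 1) * (i + 1).factorial : ℝ)) * G *
          B j ^ (j + 1)) * Real.exp ((j + 1 : ℕ) * η * s) := by
      intro j hj s hs v
      -- The lower derivatives must be bounded by powers of a single `D`; this works since `B` is
      -- monotone and at least 1, so `B i ≤ B j ≤ B j ^ i` for `1 ≤ i ≤ j`.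
      refine (norm_iteratedFDeriv_succ_comp_le_of_norm_fderiv_le h.contDiff (hCD s) hj v
        h.norm_iteratedFDeriv_le h.norm_fderiv_le (D := B j * Real.exp (η * s)) ?_).trans ?_
      · rintro i hi hij
        obtain ⟨i, rfl⟩ : ∃ l, i = l + 1 := ⟨i - 1, by omega⟩
        refine (hBd i (by omega) s hs v).trans ?_
        rw [mul_pow, ← Real.exp_nat_mul, mul_assoc _ η s]
        gcongr
        calc B (i + 1) ≤ B j := hBm hij
          _ ≤ B j ^ (i + 1) := le_self_pow₀ (hB1 j) (by omega)
      · rw [mul_pow, ← Real.exp_nat_mul, ← mul_assoc _ η s, add_mul]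
        have := hBd j hj s hs v
        refine add_le_add ?_ (le_of_eq (by ring))
        rw [mul_assoc]
        gcongr
    -- Order `j ≥ 1` uses the rate `j η`. Order 0 is bounded, but is assigned the rate `η`, the
    -- smallest one the kernel admits.
    have hM : ∀ j ≤ N, ∃ M r, 0 ≤ M ∧ η ≤ r ∧ r ≤ R ∧
        ∀ s, 0 < s → ∀ v, ‖iteratedFDeriv ℝ j (g ∘ Y s) v‖ ≤ M * Real.exp (r * s) := by
      intro j hj
      rcases j with _ | j
      · refine ⟨G, η, hG0, le_rfl, h.eta_le, fun s hs v => ?_⟩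
        have : 1 ≤ Real.exp (η * s) := Real.one_le_exp (by positivity)
        rw [norm_iteratedFDeriv_zero]
        exact (h.norm_le _).trans (le_mul_of_one_le_right hG0 this)
      · refine ⟨_, (j + 1 : ℕ) * η, ?_, ?_, h.rate_le hj, fun s hs v => hkey j hj s hs.le v⟩
        · have := hBpos (j + 1)
          have := hBpos j
          positivity
        · push_cast
          nlinarith [mul_nonneg (Nat.cast_nonneg (α := ℝ) j) hη.le]
    choose! M r hM0 hηr hrR hMb using hM
    have hHle : ∀ j ≤ N, ∀ t s, 0 < s → ∀ v,
        ‖iteratedFDeriv ℝ j (fun v => Γ t s (g (Y s v))) v‖ ≤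
          ‖Γ t s‖ * (M j * Real.exp (r j * s)) := by
      intro j hj t s hs v
      rw [hH t s v j hj]
      refine ((Γ t s).norm_compContinuousMultilinearMap_le _).trans ?_
      gcongr
      exact hMb j hj s hs v
    have hHm : ∀ t, ∀ j ≤ N, ∀ v, AEStronglyMeasurable
        (fun s => iteratedFDeriv ℝ j (fun v => Γ t s (g (Y s v))) v)
        (volume.restrict (Set.Ioi 0)) := by
      intro t j hj v
      simp only [hH t _ v j hj]
      exact isBoundedBilinearMap_compMultilinear.continuous.comp_aestronglyMeasurable
        ((h.kernel.meas t).prodMk (hgYc j hj v).aestronglyMeasurable)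
    have hT : ∀ t, HasFTaylorSeriesUpTo N (fun v => ∫ s in Set.Ioi 0, Γ t s (g (Y s v)))
        (fun v j => ∫ s in Set.Ioi 0, iteratedFDeriv ℝ j (fun v => Γ t s (g (Y s v))) v) := by
      intro t
      refine hasFTaylorSeriesUpTo_integral
        (b := fun j s => M j * C * Real.exp (r j * t) * Real.exp (-δ * |t - s|))
        (Eventually.of_forall fun s => (Γ t s).contDiff.comp (hgY s)) (hHm t)
        (fun j _ => (h.kernel.integrable_bound _ t).integrableOn) fun j hj => ?_
      filter_upwards [ae_restrict_mem measurableSet_Ioi] with s hs v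
      exact (hHle j hj t s hs v).trans (h.kernel.mul_exp_le (hηr j hj) (hrR j hj) (hM0 j hj) t s)
    have hD : ∀ t, ∀ j ≤ N, ∀ v, iteratedFDeriv ℝ j (picardIterate S Γ g (n + 1) t) v =
        iteratedFDeriv ℝ j (S t) v +
          ∫ s in Set.Ioi 0, iteratedFDeriv ℝ j (fun v => Γ t s (g (Y s v))) v := by
      intro t j hj v
      have hj' : (j : WithTop ℕ∞) ≤ N := by exact_mod_cast hj
      rw [(hT t).eq_iteratedFDeriv hj' v]
      exact iteratedFDeriv_add_apply (f := S t) ((S t).contDiff.contDiffAt)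
        (((hT t).contDiff.of_le hj').contDiffAt)
    refine ⟨fun t => (S t).contDiff.add (hT t).contDiff, fun j hj v => ?_, fun j hj t ht v => ?_⟩
    · simp only [hD _ j hj v]
      refine Continuous.add ?_ ?_
      · simp only [iteratedFDeriv_linear]
        exact isBoundedBilinearMap_compMultilinear.continuous.comp
          (h.continuous_linear.prodMk continuous_const)
      · refine h.kernel.continuous_integral (hηr j hj) (hrR j hj) (hη.le.trans (hηr j hj))
          (hM0 j hj) (fun t => hHm t j hj v) (fun s t hts => ?_)
          (fun t s hs => hHle j hj t s hs v)
        simp only [hH _ s v j hj]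
        exact ContinuousAt.comp (f := fun t => (Γ t s, iteratedFDeriv ℝ j (g ∘ Y s) v))
          isBoundedBilinearMap_compMultilinear.continuous.continuousAt
          ((h.kernel.cont s t hts).prodMk continuousAt_const)
    · rw [hD t (j + 1) hj v]
      refine (norm_add_le _ _).trans ?_
      have h1 := hS j t ht v
      have hj1 : η ≤ (j + 1 : ℕ) * η := by
        push_cast
        nlinarith [mul_nonneg (Nat.cast_nonneg (α := ℝ) j) hη.le]
      have h2 := h.kernel.norm_integral_le (t := t) (r := (j + 1 : ℕ) * η) hj1 (h.rate_le hj)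
        (M := e * B (j + 1) + (∑ i ∈ Finset.range j,
          (j.choose (i + 1) * (i + 1).factorial : ℝ)) * G * B j ^ (j + 1))
        (by have := hBpos (j + 1); have := hBpos j; positivity)
        (w := fun s => iteratedFDeriv ℝ (j + 1) (fun v => Γ t s (g (Y s v))) v)
        (fun s hs => by
          rw [hH t s v (j + 1) hj]
          refine ((Γ t s).norm_compContinuousMultilinearMap_le _).trans ?_
          gcongr
          exact hkey j hj s hs.le v)
      refine (add_le_add h1 h2).trans ?_
      rw [← hκ, ← add_mul]
      gcongr
      have := hB j
      linarith

end IsLyapunovPerronSystem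

/-- The iterates converge geometrically in the weight `exp (η t)`, uniformly in `v` because `g` is
bounded. At `t = 0` all weights equal 1, so the derivative bounds on the iterates become uniform. -/
theorem IsLyapunovPerronSystem.exists_solution {V E : Type u} [NormedAddCommGroup V]
    [NormedSpace ℝ V] [NormedAddCommGroup E] [NormedSpace ℝ E] [CompleteSpace E] {k : ℕ}
    {S : ℝ → V →L[ℝ] E} {Γ : ℝ → ℝ → E →L[ℝ] E} {g : E → E} {C δ η R a G e : ℝ}
    (h : IsLyapunovPerronSystem (k + 1) S Γ g C δ η R a G e) :
    ∃ y : ℝ → V → E, (∀ v, ContinuousOn (fun t => y t v) (Set.Ici 0)) ∧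
      (∀ v t, 0 ≤ t → y t v = S t v + ∫ s in Set.Ioi 0, Γ t s (g (y s v))) ∧
      (∃ M, 0 ≤ M ∧ ∀ v t, 0 ≤ t → ‖y t v‖ ≤ M * ‖v‖ * Real.exp (η * t)) ∧
      ContDiff ℝ k (y 0) ∧
      ∀ (z : ℝ → E) (v : V) (M : ℝ), ContinuousOn z (Set.Ici 0) →
        (∀ t, 0 ≤ t → ‖z t‖ ≤ M * Real.exp (η * t)) →
        (∀ t, 0 ≤ t → z t = S t v + ∫ s in Set.Ioi 0, Γ t s (g (z s))) →
        ∀ t, 0 ≤ t → z t = y t v := by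
  obtain ⟨B, hB1, hreg⟩ := h.picardIterate_regular
  set Y := picardIterate S Γ g with hY
  set q := C * (∫ s : ℝ, Real.exp (-δ * |s|)) * e with hq
  set κ := C * (∫ s : ℝ, Real.exp (-δ * |s|)) with hκ
  have hκ0 : 0 ≤ κ := h.factor_nonneg
  have hη := h.eta_pos
  have he0 := h.lip_nonneg
  have hG0 := h.bound_nonneg
  have hq0 : 0 ≤ q := mul_nonneg hκ0 he0
  have hq1 : q < 1 := h.small
  have hgc : Continuous g := h.contDiff.continuous
  have hYc : ∀ n v, Continuous fun t => Y n t v := by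
    intro n v
    have := (continuousMultilinearCurryFin0 ℝ V E).continuous.comp
      ((hreg n).2.1 0 (Nat.zero_le _) v)
    convert this using 2 with t
    simp
  have hYs : ∀ n t v, Y (n + 1) t v = S t v + ∫ s in Set.Ioi 0, Γ t s (g (Y n s v)) :=
    fun n t v => rfl
  have hcontr := fun {z₁ z₂ : ℝ → E} (h₁ : ContinuousOn z₁ (Set.Ici 0))
    (h₂ : ContinuousOn z₂ (Set.Ici 0)) {M : ℝ}
    (hM : ∀ s, 0 ≤ s → ‖z₁ s - z₂ s‖ ≤ M * Real.exp (η * s)) (t : ℝ) =>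
      h.kernel.norm_integral_sub_le h.eta_le hgc hη.le h.norm_le h.norm_sub_le he0 h₁ h₂ hM t
  simp only [← hκ, ← hq] at hcontr
  have hgeo : ∀ n v t, 0 ≤ t → ‖Y (n + 1) t v - Y n t v‖ ≤
      κ * G * q ^ n * Real.exp (η * t) := by
    intro n v
    induction n with
    | zero =>
      intro t ht
      rw [hYs]
      have : S t v + (∫ s in Set.Ioi 0, Γ t s (g (Y 0 s v))) - Y 0 t v =
          ∫ s in Set.Ioi 0, Γ t s (g (Y 0 s v)) := add_sub_cancel_left _ _
      rw [this, pow_zero, mul_one]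
      refine h.kernel.norm_integral_le le_rfl h.eta_le hG0 fun s hs => ?_
      refine (ContinuousLinearMap.le_opNorm _ _).trans ?_
      gcongr
      have : 1 ≤ Real.exp (η * s) := Real.one_le_exp (by positivity)
      exact (h.norm_le _).trans (le_mul_of_one_le_right hG0 this)
    | succ n ih =>
      intro t ht
      rw [hYs, hYs n, add_sub_add_left_eq_sub]
      refine (hcontr (hYc (n + 1) v).continuousOn (hYc n v).continuousOn ih t).trans
        (le_of_eq ?_)
      ring
  have hlim : ∀ t, 0 ≤ t → ∀ v, ∃ l, Tendsto (fun n => Y n t v) atTop (𝓝 l) := by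
    intro t ht v
    refine cauchySeq_tendsto_of_complete
      (cauchySeq_of_le_geometric q (κ * G * Real.exp (η * t)) hq1 fun n => ?_)
    rw [dist_comm, dist_eq_norm]
    exact (hgeo n v t ht).trans (le_of_eq (by ring))
  choose! y hy using hlim
  have hdist : ∀ n v t, 0 ≤ t → ‖Y n t v - y t v‖ ≤
      κ * G / (1 - q) * q ^ n * Real.exp (η * t) := by
    intro n v t ht
    rw [← dist_eq_norm]
    refine (dist_le_of_le_geometric_of_tendsto q (κ * G * Real.exp (η * t)) hq1 (fun n => ?_)
      (hy t ht v) n).trans (le_of_eq (by ring))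
    rw [dist_comm, dist_eq_norm]
    exact (hgeo n v t ht).trans (le_of_eq (by ring))
  have hK0 : 0 ≤ κ * G / (1 - q) := div_nonneg (mul_nonneg hκ0 hG0) (by linarith)
  have hpow : ∀ c : ℝ, Tendsto (fun n : ℕ => c * q ^ n) atTop (𝓝 0) := fun c => by
    simpa using (tendsto_pow_atTop_nhds_zero_of_lt_one hq0 hq1).const_mul c
  have hycont : ∀ v, ContinuousOn (fun t => y t v) (Set.Ici 0) := by
    intro v
    have : TendstoLocallyUniformlyOn (fun n t => Y n t v) (fun t => y t v) atTop (Set.Ici 0) := by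
      rw [Metric.tendstoLocallyUniformlyOn_iff]
      intro ε hε x hx
      refine ⟨Set.Ici 0 ∩ Set.Iio (x + 1),
        inter_mem_nhdsWithin _ (Iio_mem_nhds (by linarith)), ?_⟩
      filter_upwards [(hpow (κ * G / (1 - q) * Real.exp (η * (x + 1)))).eventually
        (gt_mem_nhds hε)] with n hn t ht
      rw [dist_comm, dist_eq_norm]
      refine (hdist n v t ht.1).trans_lt (lt_of_le_of_lt ?_ hn)
      have h1 : Real.exp (η * t) ≤ Real.exp (η * (x + 1)) := by
        have := (Set.mem_Iio.1 ht.2).le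
        gcongr
      calc _ = κ * G / (1 - q) * Real.exp (η * t) * q ^ n := by ring
        _ ≤ _ := by gcongr
    exact this.continuousOn (Frequently.of_forall fun n => (hYc n v).continuousOn)
  refine ⟨y, hycont, fun v t ht => ?_, ⟨B 1, by linarith [hB1 1], fun v t ht => ?_⟩, ?_, ?_⟩
  · refine tendsto_nhds_unique ((hy t ht v).comp (tendsto_add_atTop_nat 1)) ?_
    rw [tendsto_iff_norm_sub_tendsto_zero]
    refine squeeze_zero (fun _ => norm_nonneg _) (fun n => ?_)
      (hpow (q * (κ * G / (1 - q)) * Real.exp (η * t)))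
    simp only [Function.comp_apply, hYs, add_sub_add_left_eq_sub]
    exact (hcontr (hYc n v).continuousOn (hycont v) (hdist n v) t).trans (le_of_eq (by ring))
  -- Since the iterates vanish at `v = 0`, the first-derivative bound integrates to a bound linear
  -- in `‖v‖`, which passes to the limit.
  · have hz : ∀ n t, Y n t 0 = 0 := by
      intro n
      induction n with
      | zero => intro t; exact _root_.map_zero (S t)
      | succ n ih => intro t; rw [hYs]; simp [ih, h.map_zero]
    refine le_of_tendsto (hy t ht v).norm (Eventually.of_forall fun n => ?_)
    have hd : ∀ w, ‖fderiv ℝ (Y n t) w‖ ≤ B 1 * Real.exp (η * t) := by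
      intro w
      have := (hreg n).2.2 0 (by omega) t ht w
      rw [← norm_iteratedFDeriv_fderiv, norm_iteratedFDeriv_zero] at this
      simpa using this
    have := convex_univ.norm_image_sub_le_of_norm_fderiv_le (𝕜 := ℝ) (f := Y n t) (x := 0) (y := v)
      (fun z _ => ((hreg n).1 t).differentiable (by exact_mod_cast (by omega : k + 1 ≠ 0)) z)
      (fun z _ => hd z) trivial trivial
    rw [hz, sub_zero, sub_zero] at this
    exact this.trans (le_of_eq (by ring))
  · refine contDiff_of_tendstoUniformly_of_iteratedFDeriv_le k
      (B := ∑ j ∈ Finset.range (k + 2), B j) (f := fun n => Y n 0) (fun n => (hreg n).1 0) ?_ ?_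
    · intro n j v hj hj'
      obtain ⟨j, rfl⟩ : ∃ l, j = l + 1 := ⟨j - 1, by omega⟩
      have h1 := (hreg n).2.2 j hj' 0 le_rfl v
      rw [mul_zero, Real.exp_zero, mul_one] at h1
      exact h1.trans (Finset.single_le_sum (f := B) (fun i _ => by linarith [hB1 i])
        (Finset.mem_range.2 (by omega)))
    · rw [Metric.tendstoUniformly_iff]
      intro ε hε
      filter_upwards [(hpow (κ * G / (1 - q))).eventually (gt_mem_nhds hε)] with n hn v
      rw [dist_comm, dist_eq_norm]
      refine (hdist n v 0 le_rfl).trans_lt ?_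
      rwa [mul_zero, Real.exp_zero, mul_one]
  -- Any slowly growing fixed point is compared with the iterates themselves: the distance shrinks
  -- by `q` at each step.
  · intro z v M hz hM hfix t ht
    have key : ∀ n t, 0 ≤ t → ‖Y n t v - z t‖ ≤ (M + a * ‖v‖) * q ^ n * Real.exp (η * t) := by
      intro n
      induction n with
      | zero =>
        intro t ht
        have h1 : ‖Y 0 t v‖ ≤ a * Real.exp (η * t) * ‖v‖ :=
          ((S t).le_opNorm v).trans (mul_le_mul_of_nonneg_right (h.norm_linear_le t ht)
            (norm_nonneg _))
        have h2 := hM t ht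
        refine (_root_.norm_sub_le _ _).trans ((add_le_add h1 h2).trans (le_of_eq (by ring)))
      | succ n ih =>
        intro t ht
        rw [hfix t ht, hYs, add_sub_add_left_eq_sub]
        exact (hcontr (hYc n v).continuousOn hz ih t).trans (le_of_eq (by ring))
    refine tendsto_nhds_unique ?_ (hy t ht v)
    rw [tendsto_iff_norm_sub_tendsto_zero]
    refine squeeze_zero (fun _ => norm_nonneg _) (fun n => key n t ht) ?_
    have := hpow ((M + a * ‖v‖) * Real.exp (η * t))
    refine this.congr fun n => by ring

/-! ### Exponential dichotomies, variation of constants, and the global manifold -/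

/-- The one-parameter group `T` generated by `A` preserves the splitting given by the complementary
projections `P` and `Q`; it grows at rate at most `a` forward in time on the range of `P`, and
decays at rate at least `b` backward in time on the range of `Q`. -/
structure IsExpDichotomy {E : Type*} [NormedAddCommGroup E] [NormedSpace ℝ E]
    (A P Q : E →L[ℝ] E) (T : ℝ → E →L[ℝ] E) (C a b : ℝ) : Prop where
  map_zero : T 0 = 1
  map_add : ∀ s t, T (s + t) = T s * T t
  hasDerivAt : ∀ t, HasDerivAt T (A * T t) t
  add_eq_one : P + Q = 1
  mul_self : P * P = P
  commute : ∀ t, T t * P = P * T t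
  const_nonneg : 0 ≤ C
  norm_forward_le : ∀ t, 0 ≤ t → ‖T t * P‖ ≤ C * Real.exp (a * t)
  norm_backward_le : ∀ t, 0 ≤ t → ‖T (-t) * Q‖ ≤ C * Real.exp (-b * t)

namespace IsExpDichotomy

variable {E : Type*} [NormedAddCommGroup E] [NormedSpace ℝ E]
    {A P Q : E →L[ℝ] E} {T : ℝ → E →L[ℝ] E} {C a b : ℝ}

theorem continuous (h : IsExpDichotomy A P Q T C a b) : Continuous T :=
  continuous_iff_continuousAt.2 fun t => (h.hasDerivAt t).continuousAt

theorem eq_one_sub (h : IsExpDichotomy A P Q T C a b) : Q = 1 - P :=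
  eq_sub_of_add_eq' h.add_eq_one

theorem mul_eq_zero (h : IsExpDichotomy A P Q T C a b) : P * Q = 0 := by
  rw [h.eq_one_sub, mul_sub, mul_one, h.mul_self, sub_self]

theorem commute' (h : IsExpDichotomy A P Q T C a b) (t : ℝ) : T t * Q = Q * T t := by
  rw [h.eq_one_sub, mul_sub, sub_mul, h.commute, mul_one, one_mul]

theorem map_neg_apply (h : IsExpDichotomy A P Q T C a b) (t : ℝ) (x : E) : T t (T (-t) x) = x := by
  rw [← mul_apply_eq_comp, ← h.map_add, add_neg_cancel, h.map_zero]; rfl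

theorem map_neg_apply' (h : IsExpDichotomy A P Q T C a b) (t : ℝ) (x : E) : T (-t) (T t x) = x := by
  rw [← mul_apply_eq_comp, ← h.map_add, neg_add_cancel, h.map_zero]; rfl

theorem hasDerivAt_neg (h : IsExpDichotomy A P Q T C a b) (t : ℝ) :
    HasDerivAt (fun t => T (-t)) (-(T (-t) * A)) t := by
  -- `T` commutes with its generator: differentiate `T (t + s) = T (s + t)` at `s = 0`, factoring it
  -- in both ways.
  have hA : ∀ t, A * T t = T t * A := by
    intro t
    have h1 : HasDerivAt (fun s => T (t + s)) (T t * (A * T 0)) 0 := by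
      simp only [h.map_add t]
      exact (h.hasDerivAt 0).const_mul (T t)
    have h2 : HasDerivAt (fun s => T (s + t)) (A * T 0 * T t) 0 := by
      simp only [h.map_add _ t]
      exact (h.hasDerivAt 0).mul_const (T t)
    simp only [add_comm t] at h1
    have := h2.unique h1
    simpa [h.map_zero] using this
  have := (h.hasDerivAt (-t)).scomp t (_root_.hasDerivAt_neg t)
  rw [← hA]
  simpa [Function.comp_def] using this

end IsExpDichotomy

/-- The Green kernel of the equation `y' = A y + h` for an exponential dichotomy. -/
noncomputable def greenKernel {E : Type*} [NormedAddCommGroup E] [NormedSpace ℝ E]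
    (P Q : E →L[ℝ] E) (T : ℝ → E →L[ℝ] E) (t s : ℝ) : E →L[ℝ] E :=
  if s ≤ t then T (t - s) * P else -(T (t - s) * Q)

namespace IsExpDichotomy

variable {E : Type*} [NormedAddCommGroup E] [NormedSpace ℝ E]
    {A P Q : E →L[ℝ] E} {T : ℝ → E →L[ℝ] E} {C δ b : ℝ}

/-- Forward growth at rate `δ` leaves a margin `δ` below every `r ≥ 2 δ`; backward decay at rate `b`
leaves the same margin as long as `r + δ ≤ b`. -/
theorem isDichotomyKernel (h : IsExpDichotomy A P Q T C δ b) {η R : ℝ} (hδ : 0 < δ)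
    (hη : 2 * δ ≤ η) (hR : R + δ ≤ b) : IsDichotomyKernel (greenKernel P Q T) C δ η R where
  const_nonneg := h.const_nonneg
  delta_pos := hδ
  meas t := by
    refine StronglyMeasurable.aestronglyMeasurable ?_
    have hc := h.continuous
    refine StronglyMeasurable.ite (measurableSet_le measurable_id measurable_const) ?_ ?_
    · exact Continuous.stronglyMeasurable (by fun_prop)
    · exact Continuous.stronglyMeasurable (by fun_prop)
  cont s t hts := by
    have hc := h.continuous
    rcases lt_or_gt_of_ne hts with hlt | hlt
    · have : (fun t => greenKernel P Q T t s) =ᶠ[𝓝 t] fun t => -(T (t - s) * Q) := by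
        filter_upwards [Iio_mem_nhds hlt] with x hx
        exact if_neg (not_le.2 hx)
      exact (Continuous.continuousAt (by fun_prop)).congr this.symm
    · have : (fun t => greenKernel P Q T t s) =ᶠ[𝓝 t] fun t => T (t - s) * P := by
        filter_upwards [Ioi_mem_nhds hlt] with x hx
        exact if_pos (le_of_lt hx)
      exact (Continuous.continuousAt (by fun_prop)).congr this.symm
  bound r hr hr' t s := by
    have hC := h.const_nonneg
    rw [mul_assoc, ← Real.exp_add]
    unfold greenKernel
    split_ifs with hst
    · refine (h.norm_forward_le _ (sub_nonneg.2 hst)).trans ?_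
      rw [abs_of_nonneg (sub_nonneg.2 hst)]
      gcongr
      nlinarith
    · have hst : t < s := not_le.1 hst
      rw [norm_neg]
      have := h.norm_backward_le (s - t) (by linarith)
      rw [neg_sub] at this
      refine this.trans ?_
      rw [abs_of_neg (sub_neg.2 hst)]
      gcongr
      nlinarith

/-- As `P + Q = 1`, adding `T (t - s)` to `-T (t - s) Q` gives `T (t - s) P`. Thus the Green
integral splits into an evolved constant and an ordinary variation-of-constants integral. -/
theorem greenKernel_apply (h : IsExpDichotomy A P Q T C δ b) {s : ℝ} (hs : 0 < s)
    (t : ℝ) (x : E) : greenKernel P Q T t s x =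
      T t (greenKernel P Q T 0 s x + (Set.Iic t).indicator (fun s => T (-s) x) s) := by
  have h0 : greenKernel P Q T 0 s = -(T (-s) * Q) := by
    simp [greenKernel, not_le.2 hs]
  have hQ : ∀ x, Q x = x - P x := fun x => by rw [h.eq_one_sub]; rfl
  rw [h0, greenKernel, sub_eq_add_neg, h.map_add]
  by_cases hst : s ≤ t
  · simp [hst, hQ]
  · simp [hst]

theorem integral_greenKernel (h : IsExpDichotomy A P Q T C δ b) [CompleteSpace E] {u : ℝ → E}
    (hi : IntegrableOn (fun s => greenKernel P Q T 0 s (u s)) (Set.Ioi 0))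
    (hc : ContinuousOn u (Set.Ici 0)) {t : ℝ} (ht : 0 ≤ t) :
    ∫ s in Set.Ioi 0, greenKernel P Q T t s (u s) =
      T t ((∫ s in Set.Ioi 0, greenKernel P Q T 0 s (u s)) + ∫ s in (0 : ℝ)..t, T (-s) (u s)) := by
  have hT := h.continuous
  have h1 : ContinuousOn (fun s => T (-s) (u s)) (Set.Icc 0 t) :=
    (Continuous.continuousOn (by fun_prop)).clm_apply (hc.mono Set.Icc_subset_Ici_self)
  have h2 : IntegrableOn (fun s => T (-s) (u s)) (Set.Ioc 0 t) :=
    (h1.integrableOn_Icc).mono_set Set.Ioc_subset_Icc_self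
  have h3 : IntegrableOn ((Set.Iic t).indicator fun s => T (-s) (u s)) (Set.Ioi 0) := by
    rw [IntegrableOn, integrable_indicator_iff measurableSet_Iic, IntegrableOn,
      Measure.restrict_restrict measurableSet_Iic, Set.Iic_inter_Ioi]
    exact h2
  have h4 : ∫ s in Set.Ioi 0, (Set.Iic t).indicator (fun s => T (-s) (u s)) s =
      ∫ s in (0 : ℝ)..t, T (-s) (u s) := by
    rw [integral_indicator measurableSet_Iic, Measure.restrict_restrict measurableSet_Iic,
      Set.Iic_inter_Ioi, intervalIntegral.integral_of_le ht]
  rw [← h4, ← integral_add hi h3]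
  refine Eq.trans ?_ ((T t).integral_comp_comm (hi.add h3))
  refine setIntegral_congr_fun measurableSet_Ioi fun s hs => ?_
  rw [h.greenKernel_apply hs]
  by_cases hst : s ≤ t <;> simp [hst, -_root_.map_add]

theorem hasDerivWithinAt_of_eq_integral (h : IsExpDichotomy A P Q T C δ b) [CompleteSpace E]
    {y u : ℝ → E} {c : E} (hc : ContinuousOn u (Set.Ici 0))
    (hy : ∀ t, 0 ≤ t → y t = T t (c + ∫ s in (0 : ℝ)..t, T (-s) (u s))) {t : ℝ} (ht : 0 ≤ t) :
    HasDerivWithinAt y (A (y t) + u t) (Set.Ici 0) t := by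
  have hT := h.continuous
  -- Extending `u` by a constant to negative times makes the integrand continuous on the line, so
  -- the fundamental theorem of calculus also applies at `t = 0`.
  let w : ℝ → E := fun s => T (-s) (u (max s 0))
  have hu : Continuous fun s => u (max s 0) := by
    rw [← continuousOn_univ]
    exact hc.comp (by fun_prop) fun s _ => Set.mem_Ici.2 (le_max_right s 0)
  have hw : Continuous w := (by fun_prop : Continuous fun s => T (-s)).clm_apply hu
  have h1 : HasDerivAt (fun t => T t (c + ∫ s in (0 : ℝ)..t, w s))
      ((A * T t) (c + ∫ s in (0 : ℝ)..t, w s) + T t (w t)) t :=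
    (h.hasDerivAt t).clm_apply ((intervalIntegral.integral_hasDerivAt_right
      (hw.intervalIntegrable _ _) (hw.stronglyMeasurableAtFilter _ _) hw.continuousAt).const_add c)
  have h2 : ∀ t, 0 ≤ t → y t = T t (c + ∫ s in (0 : ℝ)..t, w s) := by
    intro t ht
    rw [hy t ht]
    congr 2
    refine intervalIntegral.integral_congr fun s hs => ?_
    rw [Set.uIcc_of_le ht] at hs
    simp [w, max_eq_left hs.1]
  have h3 : A (y t) + u t = (A * T t) (c + ∫ s in (0 : ℝ)..t, w s) + T t (w t) := by
    rw [h2 t ht]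
    simp [w, h.map_neg_apply, max_eq_left ht]
  rw [h3]
  exact h1.hasDerivWithinAt.congr h2 (h2 t ht)

theorem eq_integral_of_hasDerivWithinAt (h : IsExpDichotomy A P Q T C δ b) [CompleteSpace E]
    {y u : ℝ → E} (hc : ContinuousOn u (Set.Ici 0))
    (hy : ∀ t, 0 ≤ t → HasDerivWithinAt y (A (y t) + u t) (Set.Ici 0) t) {t : ℝ} (ht : 0 ≤ t) :
    y t = T t (y 0 + ∫ s in (0 : ℝ)..t, T (-s) (u s)) := by
  have hT := h.continuous
  let w : ℝ → E := fun s => T (-s) (u (max s 0))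
  have hu : Continuous fun s => u (max s 0) := by
    rw [← continuousOn_univ]
    exact hc.comp (by fun_prop) fun s _ => Set.mem_Ici.2 (le_max_right s 0)
  have hw : Continuous w := (by fun_prop : Continuous fun s => T (-s)).clm_apply hu
  have hint : ∫ s in (0 : ℝ)..t, T (-s) (u s) = ∫ s in (0 : ℝ)..t, w s := by
    refine intervalIntegral.integral_congr fun s hs => ?_
    rw [Set.uIcc_of_le ht] at hs
    simp [w, max_eq_left hs.1]
  have hd : ∀ x, 0 ≤ x → HasDerivWithinAt (fun x => T (-x) (y x) - ∫ s in (0 : ℝ)..x, w s) 0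
      (Set.Ici 0) x := by
    intro x hx
    have h1 := (h.hasDerivAt_neg x).hasDerivWithinAt (s := Set.Ici 0) |>.clm_apply (hy x hx)
    have h2 := (intervalIntegral.integral_hasDerivAt_right (hw.intervalIntegrable 0 x)
      (hw.stronglyMeasurableAtFilter _ _) hw.continuousAt).hasDerivWithinAt (s := Set.Ici 0)
    refine (h1.sub h2).congr_deriv ?_
    simp [w, max_eq_left hx]
  have := constant_of_has_deriv_right_zero (a := 0) (b := t)
    (fun x hx => ((hd x hx.1).continuousWithinAt).mono Set.Icc_subset_Ici_self)
    (fun x hx => (hd x hx.1).mono (Set.Ici_subset_Ici.2 hx.1)) t ⟨ht, le_rfl⟩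
  simp only [neg_zero, h.map_zero, one_apply_eq_self, intervalIntegral.integral_same,
    sub_zero] at this
  rw [hint, ← this]
  simp [h.map_neg_apply]

end IsExpDichotomy

/-- The center stable manifold of a vector field `A + g` on the whole space, for a nonlinearity `g`
which is small in the Lipschitz sense: it consists of the initial values of the solutions
of growth rate at most `η`, and it is the image of a `C^k` parametrization by the range of `P`. -/
theorem IsExpDichotomy.exists_global_centerStable {E : Type u} [NormedAddCommGroup E]
    [NormedSpace ℝ E] [CompleteSpace E] {A P Q : E →L[ℝ] E} {T : ℝ → E →L[ℝ] E} {C η b : ℝ}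
    (h : IsExpDichotomy A P Q T C (η / 2) b) (hη : 0 < η) {k : ℕ} (hk : 1 ≤ k)
    (hb : (k + 2) * η ≤ b) {g : E → E} {G e L : ℝ} (hg : ContDiff ℝ (k + 1 : ℕ) g)
    (hG : ∀ i ≤ k + 1, ∀ z, ‖iteratedFDeriv ℝ i g z‖ ≤ G) (he : ∀ z, ‖fderiv ℝ g z‖ ≤ e)
    (hsmall : C * (∫ s : ℝ, Real.exp (-(η / 2) * |s|)) * e < 1) (hL : ∀ x, ‖g x‖ ≤ L * ‖x‖ ^ 2)
    {V : Submodule ℝ E} (hPV : ∀ x, P x ∈ V) (hVP : ∀ v ∈ V, P v = v) :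
    ∃ Y : V → E, ContDiff ℝ k Y ∧ (∀ v, P (Y v) = v) ∧
      (∃ M, ∀ v, ‖Y v - v‖ ≤ M * ‖v‖ ^ 2) ∧
      (∀ v, ∃ (y : ℝ → E) (M : ℝ), y 0 = Y v ∧
        (∀ t, 0 ≤ t → HasDerivWithinAt y (A (y t) + g (y t)) (Set.Ici 0) t) ∧
        ∀ t, 0 ≤ t → ‖y t‖ ≤ M * Real.exp (η * t)) ∧
      ∀ (z : ℝ → E) (M : ℝ),
        (∀ t, 0 ≤ t → HasDerivWithinAt z (A (z t) + g (z t)) (Set.Ici 0) t) →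
        (∀ t, 0 ≤ t → ‖z t‖ ≤ M * Real.exp (η * t)) → z 0 = Y ⟨P (z 0), hPV _⟩ := by
  have hT := h.continuous
  have hC := h.const_nonneg
  have hk' : (1 : ℝ) ≤ k := by exact_mod_cast hk
  -- The top rate `(k + 1) η` plus the margin `η / 2` stays below `(k + 2) η ≤ b`.
  have hker : IsDichotomyKernel (greenKernel P Q T) C (η / 2) η ((k + 1) * η) :=
    h.isDichotomyKernel (by linarith) (by linarith) (by linarith)
  have hL0 : ∀ x, x = 0 → g x = 0 := by
    rintro x rfl
    simpa using hL 0
  let S : ℝ → V →L[ℝ] E := fun t => (T t * P).comp V.subtypeL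
  have hS : ∀ t (v : V), S t v = T t v := fun t v => by simp [S, hVP v v.2]
  have hsys : IsLyapunovPerronSystem (k + 1) S (greenKernel P Q T) g C (η / 2) η ((k + 1) * η)
      C G e :=
    { kernel := hker
      eta_pos := hη
      one_le := by omega
      rate := by push_cast; exact le_rfl
      continuous_linear := (by fun_prop : Continuous fun t => T t * P).clm_comp continuous_const
      norm_linear_le := fun t ht => by
        refine ((T t * P).opNorm_comp_le V.subtypeL).trans ?_
        have h1 : ‖V.subtypeL‖ ≤ 1 := V.norm_subtypeL_le
        have h2 := h.norm_forward_le t ht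
        calc _ ≤ (C * Real.exp (η / 2 * t)) * 1 := by gcongr
          _ ≤ _ := by rw [mul_one]; gcongr; linarith
      contDiff := hg
      norm_iteratedFDeriv_le := hG
      norm_fderiv_le := he
      small := hsmall
      map_zero := hL0 0 rfl }
  have hgc : Continuous g := hg.continuous
  have hG0 := hsys.bound_nonneg
  have hR : η ≤ (k + 1) * η := by nlinarith
  have hmeas : ∀ z : ℝ → E, ContinuousOn z (Set.Ici 0) → ∀ t,
      AEStronglyMeasurable (fun s => greenKernel P Q T t s (g (z s)))
        (volume.restrict (Set.Ioi 0)) := by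
    intro z hz t
    exact isBoundedBilinearMap_apply.continuous.comp_aestronglyMeasurable
      ((hker.meas t).prodMk ((hgc.comp_continuousOn (hz.mono
        Set.Ioi_subset_Ici_self)).aestronglyMeasurable measurableSet_Ioi))
  have hint : ∀ z : ℝ → E, ContinuousOn z (Set.Ici 0) → ∀ t,
      IntegrableOn (fun s => greenKernel P Q T t s (g (z s))) (Set.Ioi 0) := by
    intro z hz t
    refine hker.integrable (t := t) le_rfl hR hG0 (hmeas z hz t) fun s hs => ?_
    refine (ContinuousLinearMap.le_opNorm _ _).trans ?_
    gcongr
    have : 1 ≤ Real.exp (η * s) := Real.one_le_exp (by positivity)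
    exact (hsys.norm_le _).trans (le_mul_of_one_le_right hG0 this)
  have hgreen : ∀ s, 0 < s → greenKernel P Q T 0 s = -(T (-s) * Q) := fun s hs => by
    simp [greenKernel, not_le.2 hs]
  obtain ⟨y, hyc, hyfix, ⟨M, hM0, hyM⟩, hYk, huniq⟩ := hsys.exists_solution
  have hy0 : ∀ v, y 0 v = v + ∫ s in Set.Ioi 0, greenKernel P Q T 0 s (g (y s v)) := fun v => by
    rw [hyfix v 0 le_rfl, hS, h.map_zero]; rfl
  refine ⟨y 0, hYk, fun v => ?_, ⟨C * (∫ s : ℝ, Real.exp (-(η / 2) * |s|)) * (|L| * M ^ 2),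
    fun v => ?_⟩, fun v => ⟨fun t => y t v, M * ‖v‖, rfl, fun t ht => ?_, hyM v⟩, ?_⟩
  -- At `t = 0` and `s > 0` the kernel is `-T (-s) Q`, which `P` annihilates.
  · rw [hy0, _root_.map_add, hVP v v.2, ← P.integral_comp_comm (hint _ (hyc v) 0)]
    have : ∫ s in Set.Ioi 0, P (greenKernel P Q T 0 s (g (y s v))) = 0 := by
      rw [← integral_zero ℝ E (μ := volume.restrict (Set.Ioi 0))]
      refine setIntegral_congr_fun measurableSet_Ioi fun s hs => ?_
      rw [hgreen s hs, h.commute', ← mul_apply_eq_comp, mul_neg, ← mul_assoc, h.mul_eq_zero]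
      simp
    rw [this, add_zero]
  -- Tangency: `g` is quadratic, so `g (y s v)` grows at rate `2 η` with coefficient of order `‖v‖ ^
  -- 2`. The rate is admissible because `k ≥ 1`.
  · rw [hy0, add_sub_cancel_left]
    have hb2 : 2 * η ≤ (k + 1) * η := by nlinarith
    refine (hker.norm_integral_le (r := 2 * η) (t := 0) (by linarith) hb2
      (M := |L| * (M * ‖v‖) ^ 2) (by positivity) fun s hs => ?_).trans (le_of_eq ?_)
    · refine (ContinuousLinearMap.le_opNorm _ _).trans ?_
      gcongr
      calc ‖g (y s v)‖ ≤ L * ‖y s v‖ ^ 2 := hL _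
        _ ≤ |L| * ‖y s v‖ ^ 2 := by gcongr; exact le_abs_self L
        _ ≤ |L| * (M * ‖v‖ * Real.exp (η * s)) ^ 2 := by gcongr; exact hyM v s hs.le
        _ = _ := by rw [mul_pow _ (Real.exp _), ← Real.exp_nat_mul]; push_cast; ring_nf
    · simp; ring
  · refine h.hasDerivWithinAt_of_eq_integral (u := fun s => g (y s v)) (c := y 0 v)
      (hgc.comp_continuousOn (hyc v)) (fun t ht => ?_) ht
    rw [hyfix v t ht, h.integral_greenKernel (hint _ (hyc v) 0)
      (hgc.comp_continuousOn (hyc v)) ht, hS, hy0 v, ← _root_.map_add, add_assoc]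
  · intro z M' hz hzM
    have hzc : ContinuousOn z (Set.Ici 0) := fun t ht => (hz t ht).continuousWithinAt
    have hgz : ContinuousOn (fun s => g (z s)) (Set.Ici 0) := hgc.comp_continuousOn hzc
    have hzint := fun t (ht : 0 ≤ t) => h.eq_integral_of_hasDerivWithinAt hgz hz ht
    -- Slow growth fixes the unstable component: pulled back to time 0, `Q (z t)` is at most a
    -- multiple of `exp ((η - b) t)` and tends to 0, so `Q (z 0)` is the limit of the remaining
    -- integral.
    have hQ : Q (z 0) = ∫ s in Set.Ioi 0, greenKernel P Q T 0 s (g (z s)) := by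
      have hlim := intervalIntegral_tendsto_integral_Ioi (0 : ℝ) (hint z hzc 0) tendsto_id
      have hzero : Tendsto (fun t => T (-t) (Q (z t))) atTop (𝓝 0) := by
        have hlt : η - b < 0 := by nlinarith
        have h1 : Tendsto (fun t : ℝ => C * M' * Real.exp ((η - b) * t)) atTop (𝓝 0) := by
          have : Tendsto (fun t : ℝ => (η - b) * t) atTop atBot :=
            tendsto_id.const_mul_atTop_of_neg hlt
          simpa using (Real.tendsto_exp_atBot.comp this).const_mul (C * M')
        refine squeeze_zero_norm' ?_ h1
        filter_upwards [eventually_ge_atTop 0] with t ht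
        calc ‖T (-t) (Q (z t))‖ ≤ ‖T (-t) * Q‖ * ‖z t‖ := (T (-t) * Q).le_opNorm _
          _ ≤ (C * Real.exp (-b * t)) * (M' * Real.exp (η * t)) := by
            gcongr
            · exact h.norm_backward_le t ht
            · exact hzM t ht
          _ = _ := by
            rw [show (η - b) * t = -b * t + η * t by ring, Real.exp_add]; ring
      have heq : ∀ᶠ t in atTop, Q (z 0) -
          (∫ s in (0 : ℝ)..t, greenKernel P Q T 0 s (g (z s))) = T (-t) (Q (z t)) := by
        filter_upwards [eventually_ge_atTop 0] with t ht
        have hw : ContinuousOn (fun s => T (-s) (g (z s))) (Set.Icc 0 t) :=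
          (Continuous.continuousOn (by fun_prop)).clm_apply (hgz.mono Set.Icc_subset_Ici_self)
        have h2 : T (-t) (Q (z t)) = Q (z 0) + ∫ s in (0 : ℝ)..t, Q (T (-s) (g (z s))) := by
          have := congrArg (fun x => Q (T (-t) x)) (hzint t ht)
          simp only [h.map_neg_apply'] at this
          rw [← mul_apply_eq_comp, h.commute', mul_apply_eq_comp, this, _root_.map_add,
            Q.intervalIntegral_comp_comm]
          exact (hw.mono (by rw [Set.uIcc_of_le ht])).intervalIntegrable
        rw [h2, sub_eq_add_neg, ← intervalIntegral.integral_neg]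
        congr 1
        rw [intervalIntegral.integral_of_le ht, intervalIntegral.integral_of_le ht]
        refine setIntegral_congr_fun measurableSet_Ioc fun s hs => ?_
        rw [hgreen s hs.1, h.commute']
        simp
      have := (tendsto_const_nhds.sub hlim).congr' heq
      exact sub_eq_zero.1 (tendsto_nhds_unique this hzero)
    refine huniq z _ M' hzc hzM (fun t ht => ?_) 0 le_rfl
    rw [h.integral_greenKernel (hint z hzc 0) hgz ht, hS, hzint t ht, ← hQ, ← _root_.map_add,
      ← add_assoc]
    congr 2
    have := congrArg (fun B : E →L[ℝ] E => B (z 0)) h.add_eq_one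
    simpa using this.symm

/-! ### Complexification and the real spectral splitting -/

section Complexification

variable {E : Type*} [AddCommGroup E] [Module ℝ E]

/-- Complex conjugation on the complexification of a real vector space. -/
noncomputable def complexificationConj (E : Type*) [AddCommGroup E] [Module ℝ E] :
    ℂ ⊗[ℝ] E →ₗ[ℝ] ℂ ⊗[ℝ] E :=
  LinearMap.rTensor E Complex.conjAe.toLinearMap

/-- The real part of a vector of the complexification. -/
noncomputable def complexificationRe (E : Type*) [AddCommGroup E] [Module ℝ E] :
    ℂ ⊗[ℝ] E →ₗ[ℝ] E :=
  (TensorProduct.lid ℝ E).toLinearMap ∘ₗ LinearMap.rTensor E Complex.reLm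

theorem complexificationRe_one_tmul (v : E) : complexificationRe E (1 ⊗ₜ v) = v := by
  simp [complexificationRe]

theorem complexificationConj_smul (z : ℂ) (x : ℂ ⊗[ℝ] E) :
    complexificationConj E (z • x) = (starRingEnd ℂ z) • complexificationConj E x := by
  induction x with
  | zero => simp
  | tmul w v => simp [complexificationConj, TensorProduct.smul_tmul']
  | add x y hx hy => simp only [smul_add, map_add, hx, hy]

theorem complexificationConj_baseChange (A : E →ₗ[ℝ] E) (x : ℂ ⊗[ℝ] E) :
    complexificationConj E (A.baseChange ℂ x) = A.baseChange ℂ (complexificationConj E x) := by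
  induction x with
  | zero => simp
  | tmul w v => simp [complexificationConj]
  | add x y hx hy => simp only [map_add, hx, hy]

theorem one_tmul_complexificationRe (x : ℂ ⊗[ℝ] E) :
    (1 : ℂ) ⊗ₜ[ℝ] complexificationRe E x = (2⁻¹ : ℂ) • (x + complexificationConj E x) := by
  induction x with
  | zero => simp
  | tmul w v =>
    simp only [complexificationRe, complexificationConj, LinearMap.comp_apply,
      LinearMap.rTensor_tmul, LinearEquiv.coe_coe, TensorProduct.lid_tmul,
      ← TensorProduct.smul_tmul, ← TensorProduct.add_tmul, TensorProduct.smul_tmul']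
    congr 1
    apply Complex.ext <;> simp
    ring
  | add x y hx hy => simp only [map_add, TensorProduct.tmul_add, hx, hy, ← smul_add]; abel_nf

theorem complexificationConj_mem_maxGenEigenspace (A : E →ₗ[ℝ] E) {μ : ℂ} {x : ℂ ⊗[ℝ] E}
    (hx : x ∈ Module.End.maxGenEigenspace (A.baseChange ℂ) μ) :
    complexificationConj E x ∈
      Module.End.maxGenEigenspace (A.baseChange ℂ) (starRingEnd ℂ μ) := by
  rw [Module.End.mem_maxGenEigenspace] at hx ⊢
  obtain ⟨k, hk⟩ := hx
  refine ⟨k, ?_⟩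
  have : ∀ (k : ℕ) (x : ℂ ⊗[ℝ] E),
      ((A.baseChange ℂ - (starRingEnd ℂ μ) • (1 : Module.End ℂ (ℂ ⊗[ℝ] E))) ^ k)
        (complexificationConj E x) =
      complexificationConj E
        (((A.baseChange ℂ - μ • (1 : Module.End ℂ (ℂ ⊗[ℝ] E))) ^ k) x) := by
    intro k
    induction k with
    | zero => intro x; simp
    | succ k ih =>
      intro x
      rw [pow_succ, pow_succ, Module.End.mul_apply, Module.End.mul_apply, ← ih]
      congr 1
      simp only [LinearMap.sub_apply, LinearMap.smul_apply, Module.End.one_apply, map_sub,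
        complexificationConj_smul, complexificationConj_baseChange]
  rw [this, hk, map_zero]

variable (A : E →ₗ[ℝ] E) {S : Set ℂ}

theorem complexificationConj_mem_biSup (hS : ∀ μ ∈ S, starRingEnd ℂ μ ∈ S) {x : ℂ ⊗[ℝ] E}
    (hx : x ∈ ⨆ μ ∈ S, Module.End.maxGenEigenspace (A.baseChange ℂ) μ) :
    complexificationConj E x ∈ ⨆ μ ∈ S, Module.End.maxGenEigenspace (A.baseChange ℂ) μ := by
  rw [iSup_subtype'] at hx
  induction hx using Submodule.iSup_induction' with
  | mem μ x hx =>
    exact Submodule.mem_iSup_of_mem _ (Submodule.mem_iSup_of_mem (hS μ μ.2)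
      (complexificationConj_mem_maxGenEigenspace A hx))
  | zero => simp
  | add x y _ _ hx hy => rw [map_add]; exact add_mem hx hy

theorem mem_realSpectralSubspace {v : E} : v ∈ realSpectralSubspace A S ↔
    (1 : ℂ) ⊗ₜ[ℝ] v ∈ ⨆ μ ∈ S, Module.End.maxGenEigenspace (A.baseChange ℂ) μ :=
  Iff.rfl

/-- Conjugation permutes the generalized eigenspaces of a real operator, so the average of a vector
and its conjugate stays in a conjugation-invariant sum. -/
theorem complexificationRe_mem_realSpectralSubspace (hS : ∀ μ ∈ S, starRingEnd ℂ μ ∈ S)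
    {x : ℂ ⊗[ℝ] E} (hx : x ∈ ⨆ μ ∈ S, Module.End.maxGenEigenspace (A.baseChange ℂ) μ) :
    complexificationRe E x ∈ realSpectralSubspace A S := by
  rw [mem_realSpectralSubspace, one_tmul_complexificationRe]
  exact Submodule.smul_mem _ _ (add_mem hx (complexificationConj_mem_biSup A hS hx))

theorem apply_mem_realSpectralSubspace {v : E} (hv : v ∈ realSpectralSubspace A S) :
    A v ∈ realSpectralSubspace A S := by
  rw [mem_realSpectralSubspace] at hv ⊢
  have h : ∀ x ∈ ⨆ μ ∈ S, Module.End.maxGenEigenspace (A.baseChange ℂ) μ,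
      A.baseChange ℂ x ∈ ⨆ μ ∈ S, Module.End.maxGenEigenspace (A.baseChange ℂ) μ := by
    intro x hx
    rw [iSup_subtype'] at hx
    induction hx using Submodule.iSup_induction' with
    | mem μ x hx =>
      exact Submodule.mem_iSup_of_mem _ (Submodule.mem_iSup_of_mem μ.2
        (Module.End.mapsTo_maxGenEigenspace_of_comm (Commute.refl _) _ hx))
    | zero => simp
    | add x y _ _ hx hy => rw [map_add]; exact add_mem hx hy
  simpa using h _ hv

/-- Over `ℂ` the generalized eigenspaces are independent and span; real parts bring the
decomposition back to `E`. -/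
theorem isCompl_realSpectralSubspace [FiniteDimensional ℝ E] {S' : Set ℂ} (hd : Disjoint S S')
    (hu : S ∪ S' = Set.univ)
    (hS : ∀ μ ∈ S, starRingEnd ℂ μ ∈ S) (hS' : ∀ μ ∈ S', starRingEnd ℂ μ ∈ S') :
    IsCompl (realSpectralSubspace A S) (realSpectralSubspace A S') := by
  constructor
  · rw [Submodule.disjoint_def]
    intro v hv hv'
    have h := (Module.End.independent_maxGenEigenspace (A.baseChange ℂ)).disjoint_biSup_biSup hd
    have h0 := Submodule.disjoint_def.1 h _ hv hv'
    rw [← complexificationRe_one_tmul v]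
    exact (congrArg _ h0).trans (map_zero _)
  · rw [codisjoint_iff, eq_top_iff]
    intro v _
    have htop : (⨆ μ ∈ S, Module.End.maxGenEigenspace (A.baseChange ℂ) μ) ⊔
        (⨆ μ ∈ S', Module.End.maxGenEigenspace (A.baseChange ℂ) μ) = ⊤ := by
      rw [← iSup_union, hu, iSup_univ]
      exact Module.End.iSup_maxGenEigenspace_eq_top _
    have hv : (1 : ℂ) ⊗ₜ[ℝ] v ∈ (⊤ : Submodule ℂ (ℂ ⊗[ℝ] E)) := trivial
    rw [← htop] at hv
    obtain ⟨a, ha, b, hb, hab⟩ := Submodule.mem_sup.1 hv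
    rw [← complexificationRe_one_tmul v, ← hab, map_add]
    exact Submodule.add_mem_sup (complexificationRe_mem_realSpectralSubspace A hS ha)
      (complexificationRe_mem_realSpectralSubspace A hS' hb)

theorem isCompl_centerStableSubspace_unstableSubspace [FiniteDimensional ℝ E] :
    IsCompl (centerStableSubspace A) (unstableSubspace A) := by
  refine isCompl_realSpectralSubspace A ?_ ?_ (fun μ hμ => ?_) (fun μ hμ => ?_)
  · exact Set.disjoint_left.2 fun μ hμ hμ' => not_lt.2 (show μ.re ≤ 0 from hμ) hμ'
  · exact Set.eq_univ_of_forall fun μ => le_or_gt μ.re 0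
  · simpa using hμ
  · simpa using hμ

end Complexification

/-! ### Growth of the exponential on spectral subspaces -/

section ExpGrowth

variable {W : Type*} [NormedAddCommGroup W] [NormedSpace ℂ W] [CompleteSpace W]

theorem exp_apply_eq_sum_of_pow_apply_eq_zero {N : W →L[ℂ] W} {m : ℕ} {w : W}
    (hN : (N ^ m) w = 0) (t : ℂ) :
    NormedSpace.exp (t • N) w =
      ∑ j ∈ Finset.range m, ((j.factorial⁻¹ : ℂ) * t ^ j) • (N ^ j) w := by
  have h1 := (NormedSpace.exp_series_hasSum_exp' (𝕂 := ℂ) (t • N)).mapL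
    (ContinuousLinearMap.apply ℂ W w)
  refine h1.unique ?_
  have h2 : ∀ j, ContinuousLinearMap.apply ℂ W w ((j.factorial⁻¹ : ℂ) • (t • N) ^ j) =
      ((j.factorial⁻¹ : ℂ) * t ^ j) • (N ^ j) w := by
    intro j
    simp [smul_pow, smul_smul]
  simp only [h2]
  refine hasSum_sum_of_ne_finset_zero fun j hj => ?_
  rw [Finset.mem_range, not_lt] at hj
  obtain ⟨l, rfl⟩ := Nat.exists_eq_add_of_le' hj
  rw [pow_add N, mul_apply_eq_comp, hN, map_zero, smul_zero]

/-- On a generalized eigenvector the orbit is `exp (t μ)` times a polynomial in `t`. The gap `ε = a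
- Re μ` absorbs the polynomial through `(ε t) ^ j / j! ≤ exp (ε t)`. -/
theorem exists_norm_exp_apply_le {B : W →L[ℂ] W} {μ : ℂ} {m : ℕ} {w : W}
    (hw : ((B - μ • (1 : W →L[ℂ] W)) ^ m) w = 0) {a : ℝ} (ha : μ.re < a) :
    ∃ C, ∀ t : ℝ, 0 ≤ t → ‖NormedSpace.exp ((t : ℂ) • B) w‖ ≤ C * Real.exp (a * t) := by
  set N := B - μ • (1 : W →L[ℂ] W) with hNdef
  set ε := a - μ.re with hε
  have hε0 : 0 < ε := sub_pos.2 ha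
  refine ⟨∑ j ∈ Finset.range m, (ε ^ j)⁻¹ * ‖(N ^ j) w‖, fun t ht => ?_⟩
  have hexp : NormedSpace.exp ((t : ℂ) • B) w =
      Complex.exp (t * μ) • NormedSpace.exp ((t : ℂ) • N) w := by
    let : NormedAlgebra ℚ (W →L[ℂ] W) := .restrictScalars ℚ ℂ _
    have h1 : (t : ℂ) • B = algebraMap ℂ (W →L[ℂ] W) (t * μ) + (t : ℂ) • N := by
      rw [hNdef, Algebra.algebraMap_eq_smul_one, smul_sub, smul_smul]
      abel
    rw [h1, NormedSpace.exp_add_of_commute (Algebra.commutes _ _),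
      ← NormedSpace.algebraMap_exp_comm, Algebra.algebraMap_eq_smul_one, smul_mul_assoc, one_mul,
      Complex.exp_eq_exp_ℂ]
    rfl
  rw [hexp, norm_smul, Complex.norm_exp, exp_apply_eq_sum_of_pow_apply_eq_zero hw]
  have hre : ((t : ℂ) * μ).re = μ.re * t := by simp [mul_comm]
  have hat : a * t = μ.re * t + ε * t := by rw [hε]; ring
  rw [hre, hat, Real.exp_add, mul_left_comm]
  gcongr
  rw [Finset.sum_mul]
  refine (norm_sum_le _ _).trans (Finset.sum_le_sum fun j _ => ?_)
  rw [norm_smul, norm_mul, norm_inv, norm_pow, Complex.norm_natCast, Complex.norm_real,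
    Real.norm_of_nonneg ht]
  have h3 := Real.pow_div_factorial_le_exp (ε * t) (mul_nonneg hε0.le ht) j
  have h4 : ((j.factorial : ℝ)⁻¹ * t ^ j) = (ε ^ j)⁻¹ * ((ε * t) ^ j / j.factorial) := by
    rw [mul_pow]; field_simp
  rw [h4]
  calc _ ≤ (ε ^ j)⁻¹ * Real.exp (ε * t) * ‖(N ^ j) w‖ := by gcongr
    _ = _ := by ring

end ExpGrowth

/-- The vectors whose orbit under the family `T` grows at an exponential rate which is strictly
smaller than `a`. -/
def expGrowthSubmodule {𝕜 W : Type*} [NontriviallyNormedField 𝕜] [NormedAddCommGroup W]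
    [NormedSpace 𝕜 W] (T : ℝ → W →L[𝕜] W) (a : ℝ) : Submodule 𝕜 W where
  carrier := {v | ∃ c < a, ∃ C, ∀ t : ℝ, 0 ≤ t → ‖T t v‖ ≤ C * Real.exp (c * t)}
  add_mem' := by
    rintro v w ⟨c, hc, C, hv⟩ ⟨d, hd, D, hw⟩
    refine ⟨max c d, max_lt hc hd, |C| + |D|, fun t ht => ?_⟩
    rw [map_add, add_mul]
    refine (norm_add_le _ _).trans (add_le_add ((hv t ht).trans ?_) ((hw t ht).trans ?_))
    · gcongr
      · exact le_abs_self C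
      · exact le_max_left _ _
    · gcongr
      · exact le_abs_self D
      · exact le_max_right _ _
  zero_mem' := ⟨a - 1, by linarith, 0, fun t _ => by simp⟩
  smul_mem' := by
    rintro r v ⟨c, hc, C, hv⟩
    refine ⟨c, hc, ‖r‖ * C, fun t ht => ?_⟩
    rw [map_smul, norm_smul, mul_assoc]
    exact mul_le_mul_of_nonneg_left (hv t ht) (norm_nonneg _)

section RealExp

variable {E : Type*} [NormedAddCommGroup E] [NormedSpace ℝ E] [FiniteDimensional ℝ E]

theorem exp_apply_semiconj {W : Type*} [NormedAddCommGroup W] [NormedSpace ℂ W] [CompleteSpace W]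
    {A : E →L[ℝ] E} {B : W →L[ℂ] W} {ι : E →L[ℝ] W} (h : ∀ v, ι (A v) = B (ι v)) (t : ℝ) (v : E) :
    ι (NormedSpace.exp (t • A) v) = NormedSpace.exp ((t : ℂ) • B) (ι v) := by
  have h1 := ((NormedSpace.exp_series_hasSum_exp' (𝕂 := ℝ) (t • A)).mapL
    (ContinuousLinearMap.apply ℝ E v)).mapL ι
  have h2 := (NormedSpace.exp_series_hasSum_exp' (𝕂 := ℂ) ((t : ℂ) • B)).mapL
    (ContinuousLinearMap.apply ℂ W (ι v))
  refine h1.unique (h2.congr_fun fun j => ?_)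
  have h3 : ∀ j : ℕ, ι ((A ^ j) v) = (B ^ j) (ι v) := by
    intro j
    induction j with
    | zero => rfl
    | succ j ih => rw [pow_succ', pow_succ', mul_apply_eq_comp, mul_apply_eq_comp, h, ih]
  simp only [ContinuousLinearMap.apply_apply, smul_pow, smul_smul, map_smul, h3]
  rw [← Complex.coe_smul]
  push_cast
  rfl

/-- The complexification is carried to `ℂ^m` to have a norm; the embedding of `E` is injective in
finite dimension, hence bounded below, so growth estimates descend. The sign `σ = ±1` covers both
time directions. -/
theorem realSpectralSubspace_le_expGrowthSubmodule (A : E →L[ℝ] E) {S : Set ℂ} {a σ : ℝ}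
    (hS : ∀ μ ∈ S, σ * μ.re < a) :
    realSpectralSubspace (A : E →ₗ[ℝ] E) S ≤
      expGrowthSubmodule (fun t => NormedSpace.exp (t • σ • A)) a := by
  let b := Module.finBasis ℂ (ℂ ⊗[ℝ] E)
  let e := b.equivFun
  let W := Fin (Module.finrank ℂ (ℂ ⊗[ℝ] E)) → ℂ
  let B : W →L[ℂ] W := LinearMap.toContinuousLinearMap
    (e.toLinearMap ∘ₗ (A : E →ₗ[ℝ] E).baseChange ℂ ∘ₗ e.symm.toLinearMap)
  have hB : ∀ x, B (e x) = e ((A : E →ₗ[ℝ] E).baseChange ℂ x) := fun x => by simp [B]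
  let ι₀ : E →ₗ[ℝ] W :=
    (e.toLinearMap.restrictScalars ℝ) ∘ₗ TensorProduct.mk ℝ ℂ E 1
  have hι₀ : Function.Injective ι₀ := by
    refine e.injective.comp fun v w hvw => ?_
    rw [← complexificationRe_one_tmul v, ← complexificationRe_one_tmul w]
    exact congrArg _ hvw
  let ι := LinearMap.toContinuousLinearMap ι₀
  have hι : ∀ v, ι v = e (1 ⊗ₜ v) := fun v => rfl
  obtain ⟨K, hK, hanti⟩ := ι₀.exists_antilipschitzWith (LinearMap.ker_eq_bot.2 hι₀)
  have hconj : ∀ v, ι ((σ • A) v) = ((σ : ℂ) • B) (ι v) := by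
    intro v
    rw [smul_apply, map_smul, smul_apply, hι v, hB, Complex.coe_smul, hι]
    simp
  have hgrowth : ∀ x ∈ ⨆ μ ∈ S, Module.End.maxGenEigenspace ((A : E →ₗ[ℝ] E).baseChange ℂ) μ,
      e x ∈ expGrowthSubmodule (fun t : ℝ => NormedSpace.exp ((t : ℂ) • (σ : ℂ) • B)) a := by
    intro x hx
    suffices h : (⨆ μ ∈ S, Module.End.maxGenEigenspace ((A : E →ₗ[ℝ] E).baseChange ℂ) μ) ≤
        (expGrowthSubmodule (fun t : ℝ => NormedSpace.exp ((t : ℂ) • (σ : ℂ) • B)) a).comap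
          e.toLinearMap from h hx
    refine iSup₂_le fun μ hμ x hx => ?_
    obtain ⟨m, hm⟩ := (Module.End.mem_maxGenEigenspace _ _ _).1 hx
    obtain ⟨c, hc, hca⟩ := exists_between (hS μ hμ)
    have hpow : ∀ m : ℕ, ∀ x, (((σ : ℂ) • B - ((σ : ℂ) * μ) • (1 : W →L[ℂ] W)) ^ m) (e x) = (σ : ℂ) ^ m •
        e ((((A : E →ₗ[ℝ] E).baseChange ℂ - μ • (1 : Module.End ℂ (ℂ ⊗[ℝ] E))) ^ m) x) := by
      intro m
      induction m with
      | zero => intro x; simp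
      | succ m ih =>
        intro x
        have h1 : ((σ : ℂ) • B - ((σ : ℂ) * μ) • (1 : W →L[ℂ] W)) (e x) = (σ : ℂ) •
            e (((A : E →ₗ[ℝ] E).baseChange ℂ - μ • (1 : Module.End ℂ (ℂ ⊗[ℝ] E))) x) := by
          simp [hB, smul_sub, smul_smul]
        rw [pow_succ, mul_apply_eq_comp, h1, map_smul, ih, smul_smul, ← pow_succ',
          pow_succ (_ - _), Module.End.mul_apply]
    obtain ⟨C, hC⟩ := exists_norm_exp_apply_le (B := (σ : ℂ) • B) (μ := (σ : ℂ) * μ) (m := m)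
      (w := e x) (by rw [hpow, hm, map_zero, smul_zero]) (a := c) (by simpa using hc)
    exact ⟨c, hca, C, hC⟩
  intro v hv
  obtain ⟨c, hc, C, hC⟩ := hgrowth _ (mem_realSpectralSubspace _ |>.1 hv)
  refine ⟨c, hc, K * C, fun t ht => ?_⟩
  have h1 := hanti.le_mul_dist (NormedSpace.exp (t • σ • A) v) 0
  rw [map_zero, dist_zero_right, dist_zero_right] at h1
  refine h1.trans ?_
  rw [mul_assoc]
  refine mul_le_mul_of_nonneg_left ?_ K.2
  have h2 := exp_apply_semiconj hconj t v
  have h3 := hC t ht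
  rw [← hι, ← h2] at h3
  exact h3

end RealExp

/-! ### The dichotomy of the matrix exponential -/

section ExistsDichotomy

variable {E : Type*} [NormedAddCommGroup E] [NormedSpace ℝ E]

/-- Uniform boundedness principle for the rescaled operators `exp (-c t) T t R`. -/
theorem exists_norm_mul_le_of_forall_exists [CompleteSpace E] {T : ℝ → E →L[ℝ] E} {R : E →L[ℝ] E}
    {c : ℝ} (h : ∀ x, ∃ C, ∀ t : ℝ, 0 ≤ t → ‖T t (R x)‖ ≤ C * Real.exp (c * t)) :
    ∃ C, 0 ≤ C ∧ ∀ t : ℝ, 0 ≤ t → ‖T t * R‖ ≤ C * Real.exp (c * t) := by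
  obtain ⟨C, hC⟩ := banach_steinhaus (g := fun t : {t : ℝ // 0 ≤ t} =>
    Real.exp (-(c * t)) • (T t * R)) (fun x => by
      obtain ⟨C, hC⟩ := h x
      refine ⟨C, fun t => ?_⟩
      have := hC t t.2
      rw [smul_apply, norm_smul, Real.norm_of_nonneg (Real.exp_pos _).le, Real.exp_neg,
        inv_mul_le_iff₀ (Real.exp_pos _), mul_comm]
      exact this)
  refine ⟨C, (norm_nonneg _).trans (hC ⟨0, le_rfl⟩), fun t ht => ?_⟩
  have := hC ⟨t, ht⟩
  rwa [norm_smul, Real.norm_of_nonneg (Real.exp_pos _).le, Real.exp_neg,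
    inv_mul_le_iff₀ (Real.exp_pos _), mul_comm] at this

variable [FiniteDimensional ℝ E]

theorem exists_uniform_rate {T : ℝ → E →L[ℝ] E} {R : E →L[ℝ] E} {a : ℝ}
    (h : ∀ x, R x ∈ expGrowthSubmodule T a) :
    ∃ c < a, ∀ x, ∃ C, ∀ t : ℝ, 0 ≤ t → ‖T t (R x)‖ ≤ C * Real.exp (c * t) := by
  let b := Module.finBasis ℝ E
  choose r hr C hC using fun i => h (b i)
  have hev : ∀ᶠ c in 𝓝[<] a, ∀ i, r i < c :=
    eventually_all.2 fun i => mem_of_superset (Ioo_mem_nhdsLT (hr i)) fun c hc => hc.1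
  obtain ⟨c, hrc, hca⟩ := (hev.and self_mem_nhdsWithin).exists
  refine ⟨c, hca, fun x => ⟨∑ i, |b.repr x i| * |C i|, fun t ht => ?_⟩⟩
  conv_lhs => rw [← b.sum_repr x]
  rw [map_sum, map_sum, Finset.sum_mul]
  refine (norm_sum_le _ _).trans (Finset.sum_le_sum fun i _ => ?_)
  rw [map_smul, map_smul, norm_smul, Real.norm_eq_abs, mul_assoc]
  gcongr
  refine (hC i t ht).trans ?_
  gcongr
  · exact le_abs_self _
  · exact (hrc i).le

theorem exists_isExpDichotomy (A : E →L[ℝ] E) :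
    ∃ b > 0, ∃ P Q : E →L[ℝ] E,
      (∀ x, P x ∈ centerStableSubspace (A : E →ₗ[ℝ] E)) ∧
      (∀ v ∈ centerStableSubspace (A : E →ₗ[ℝ] E), P v = v) ∧
      (∀ x, Q x ∈ unstableSubspace (A : E →ₗ[ℝ] E)) ∧
      ∀ a > 0, ∃ C, IsExpDichotomy A P Q (fun t => NormedSpace.exp (t • A)) C a b := by
  have : CompleteSpace E := FiniteDimensional.complete ℝ E
  set Vc := centerStableSubspace (A : E →ₗ[ℝ] E) with hVc
  set Vu := unstableSubspace (A : E →ₗ[ℝ] E) with hVu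
  have hcompl : IsCompl Vc Vu := isCompl_centerStableSubspace_unstableSubspace _
  let P : E →L[ℝ] E := LinearMap.toContinuousLinearMap (Vc.projection Vu hcompl)
  have hP : ∀ x, P x = Vc.projection Vu hcompl x := fun x => rfl
  have hPmem : ∀ x, P x ∈ Vc := fun x => Submodule.projection_apply_mem hcompl x
  have hPid : ∀ v ∈ Vc, P v = v := fun v hv => Submodule.projection_apply_of_mem_left hcompl hv
  have hQmem : ∀ x, (1 - P) x ∈ Vu := fun x => by
    rw [← Submodule.projection_apply_eq_zero_iff hcompl, ← hP]
    change P (x - P x) = 0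
    rw [map_sub, hPid _ (hPmem x), sub_self]
  have hP0 : ∀ v ∈ Vu, P v = 0 := fun v hv =>
    (Submodule.projection_apply_eq_zero_iff hcompl).2 hv
  have hcs : Vc ≤ ⨅ a : {a : ℝ // 0 < a}, expGrowthSubmodule
      (fun t => NormedSpace.exp (t • (1 : ℝ) • A)) a :=
    le_iInf fun a => realSpectralSubspace_le_expGrowthSubmodule A fun μ hμ => by
      have hμ : μ.re ≤ 0 := hμ
      linarith [a.2]
  have hun : Vu ≤ expGrowthSubmodule (fun t => NormedSpace.exp (t • (-1 : ℝ) • A)) 0 :=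
    realSpectralSubspace_le_expGrowthSubmodule A fun μ hμ => by
      have hμ : 0 < μ.re := hμ
      linarith
  -- The rates on finitely many basis vectors are strictly negative, hence so is a common one; `-c`
  -- is the spectral gap, chosen before the center rate `a`.
  obtain ⟨c, hc, hcb⟩ := exists_uniform_rate fun x => hun (hQmem x)
  obtain ⟨C₁, hC₁, hb₁⟩ := exists_norm_mul_le_of_forall_exists hcb
  have hcomm : Commute A P := by
    refine ContinuousLinearMap.ext fun x => ?_
    change A (P x) = P (A x)
    have h1 : A x = A (P x) + A ((1 - P) x) := by
      rw [← map_add]; congr 1; change x = P x + (x - P x); abel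
    have h2 : P (A (P x)) = A (P x) := hPid _ (apply_mem_realSpectralSubspace _ (hPmem x))
    have h3 : P (A ((1 - P) x)) = 0 := hP0 _ (apply_mem_realSpectralSubspace _ (hQmem x))
    rw [h1, map_add, h2, h3, add_zero]
  refine ⟨-c, by linarith, P, 1 - P, hPmem, hPid, hQmem, fun a ha => ?_⟩
  obtain ⟨d, hd, hda⟩ := exists_uniform_rate fun x =>
    (Submodule.mem_iInf _).1 (hcs (hPmem x)) ⟨a, ha⟩
  obtain ⟨C₂, hC₂, hb₂⟩ := exists_norm_mul_le_of_forall_exists hda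
  simp only [one_smul] at hb₂
  refine ⟨max C₁ C₂, ?_⟩
  exact
    { map_zero := by rw [zero_smul, NormedSpace.exp_zero]
      map_add := fun s t => by
        let : NormedAlgebra ℚ (E →L[ℝ] E) := .restrictScalars ℚ ℝ _
        rw [add_smul]
        exact NormedSpace.exp_add_of_commute
          (((Commute.refl A).smul_left s).smul_right t)
      hasDerivAt := fun t => hasDerivAt_exp_smul_const' A t
      add_eq_one := add_sub_cancel _ _
      mul_self := ContinuousLinearMap.ext fun x => hPid _ (hPmem x)
      commute := fun t => ((hcomm.smul_left t).exp_left).eq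
      const_nonneg := hC₁.trans (le_max_left _ _)
      norm_forward_le := fun t ht => by
        refine (hb₂ t ht).trans ?_
        gcongr
        exact le_max_right _ _
      norm_backward_le := fun t ht => by
        have := hb₁ t ht
        rw [smul_smul, mul_neg_one] at this
        rw [neg_neg]
        refine this.trans ?_
        gcongr
        exact le_max_left _ _ }

end ExistsDichotomy

/-! ### Cutting off the nonlinearity -/

section Cutoff

variable {E : Type*} [NormedAddCommGroup E] [NormedSpace ℝ E]

theorem norm_le_mul_norm_sq_of_iteratedFDeriv_two_le {g : E → E} (hg : ContDiff ℝ 2 g) {L : ℝ}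
    (hL : ∀ z, ‖iteratedFDeriv ℝ 2 g z‖ ≤ L) (h0 : g 0 = 0) (h1 : fderiv ℝ g 0 = 0) (x : E) :
    ‖g x‖ ≤ L * ‖x‖ ^ 2 := by
  have hL0 : 0 ≤ L := (norm_nonneg _).trans (hL 0)
  have hg' : ContDiff ℝ 1 (fderiv ℝ g) := hg.fderiv_right (by norm_num)
  have hd : ∀ z, ‖fderiv ℝ g z‖ ≤ L * ‖z‖ := by
    intro z
    have := convex_univ.norm_image_sub_le_of_norm_fderiv_le (𝕜 := ℝ) (f := fderiv ℝ g)
      (C := L) (fun z _ => hg'.differentiable (by norm_num) z) (fun z _ => by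
        have := hL z
        rwa [← norm_iteratedFDeriv_fderiv, ← norm_iteratedFDeriv_fderiv,
          norm_iteratedFDeriv_zero] at this)
      (Set.mem_univ (0 : E)) (Set.mem_univ z)
    simpa [h1] using this
  have := (convex_closedBall (0 : E) ‖x‖).norm_image_sub_le_of_norm_fderiv_le (𝕜 := ℝ) (f := g)
    (C := L * ‖x‖) (fun z _ => hg.differentiable (by norm_num) z) (fun z hz => (hd z).trans (by
      gcongr; simpa using hz)) (x := 0) (y := x) (by simp) (by simp)
  rw [h0, sub_zero, sub_zero] at this
  exact this.trans (le_of_eq (by ring))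

theorem exists_cutoff [FiniteDimensional ℝ E] [HasContDiffBump E] {k : ℕ} (hk : 1 ≤ k)
    {f : E → E} (hf : ContDiff ℝ (k + 1 : ℕ) f)
    (h0 : f 0 = 0) (h1 : fderiv ℝ f 0 = 0) {e : ℝ} (he : 0 < e) :
    ∃ (ρ : ℝ) (g : E → E) (G L : ℝ), 0 < ρ ∧ ContDiff ℝ (k + 1 : ℕ) g ∧
      (∀ i ≤ k + 1, ∀ z, ‖iteratedFDeriv ℝ i g z‖ ≤ G) ∧ (∀ z, ‖fderiv ℝ g z‖ ≤ e) ∧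
      (∀ x, ‖g x‖ ≤ L * ‖x‖ ^ 2) ∧ ∀ x, ‖x‖ < ρ → g x = f x := by
  let χ : ContDiffBump (0 : E) := ⟨1, 2, one_pos, one_lt_two⟩
  have hχ : ContDiff ℝ (k + 1 : ℕ) χ := χ.contDiff
  have hk0 : ((k + 1 : ℕ) : WithTop ℕ∞) ≠ 0 := by exact_mod_cast Nat.succ_ne_zero k
  obtain ⟨K, hK⟩ := (hχ.continuous_fderiv hk0).bounded_above_of_compact_support
    (χ.hasCompactSupport.fderiv (𝕜 := ℝ))
  have hK0 : 0 ≤ K := (norm_nonneg _).trans (hK 0)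
  -- The product rule will give `‖Dg‖ ≤ κ + 2 K κ = e`: where the cutoff varies, its derivative is
  -- at most `K / ρ`, while `‖f‖ ≤ κ * 2 ρ`.
  set κ := e / (2 * K + 1) with hκ
  have hκ0 : 0 < κ := by positivity
  obtain ⟨r, hr, hrκ⟩ : ∃ r > 0, ∀ x : E, ‖x‖ < r → ‖fderiv ℝ f x‖ < κ := by
    have := Metric.continuousAt_iff.1 ((hf.continuous_fderiv hk0).continuousAt (x := (0 : E))) κ hκ0
    simpa [h1] using this
  have hfx : ∀ x : E, ‖x‖ < r → ‖f x‖ ≤ κ * ‖x‖ := by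
    intro x hx
    have := (convex_ball (0 : E) r).norm_image_sub_le_of_norm_fderiv_le (𝕜 := ℝ) (f := f)
      (C := κ) (fun z _ => hf.differentiable hk0 z)
      (fun z hz => (hrκ z (by simpa using hz)).le) (x := 0) (y := x) (by simpa using hr)
      (by simpa using hx)
    simpa [h0] using this
  -- The cutoff is supported in radius `2 ρ < r`, where the bounds on `f` hold.
  set ρ := r / 3 with hρ
  have hρ0 : 0 < ρ := by positivity
  have hχρ : ContDiff ℝ (k + 1 : ℕ) fun x : E => χ (ρ⁻¹ • x) :=
    hχ.comp (contDiff_const_smul ρ⁻¹)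
  let g : E → E := fun x => χ (ρ⁻¹ • x) • f x
  have hg : ContDiff ℝ (k + 1 : ℕ) g := hχρ.smul hf
  have hgeq : ∀ x, ‖x‖ < ρ → g x = f x := by
    intro x hx
    have : χ (ρ⁻¹ • x) = 1 := by
      refine χ.one_of_mem_closedBall ?_
      rw [mem_closedBall_zero_iff, norm_smul, norm_inv, Real.norm_of_nonneg hρ0.le,
        inv_mul_le_iff₀ hρ0]
      simpa [χ] using hx.le
    simp [g, this]
  have hsupp : HasCompactSupport g := by
    refine HasCompactSupport.smul_right ?_
    exact χ.hasCompactSupport.comp_homeomorph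
      (Homeomorph.smulOfNeZero ρ⁻¹ (inv_ne_zero hρ0.ne'))
  have hbound : ∀ i ≤ k + 1, ∃ C, ∀ z, ‖iteratedFDeriv ℝ i g z‖ ≤ C := fun i hi =>
    (hg.continuous_iteratedFDeriv (by exact_mod_cast hi)).bounded_above_of_compact_support
      (hsupp.iteratedFDeriv i)
  choose! C hC using hbound
  have hG : ∀ i ≤ k + 1, ∀ z, ‖iteratedFDeriv ℝ i g z‖ ≤ ∑ j ∈ Finset.range (k + 2), |C j| :=
    fun i hi z => ((hC i hi z).trans (le_abs_self _)).trans
      (Finset.single_le_sum (f := fun j => |C j|) (fun j _ => abs_nonneg _)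
        (Finset.mem_range.2 (by omega)))
  have hfd : ∀ x, HasFDerivAt g (χ (ρ⁻¹ • x) • fderiv ℝ f x +
      (ρ⁻¹ • fderiv ℝ χ (ρ⁻¹ • x)).smulRight (f x)) x := by
    intro x
    have h2 : HasFDerivAt (fun x : E => χ (ρ⁻¹ • x)) (ρ⁻¹ • fderiv ℝ χ (ρ⁻¹ • x)) x := by
      have h3 := ((hχ.differentiable hk0 (ρ⁻¹ • x)).hasFDerivAt).comp x
        ((hasFDerivAt_id x).const_smul ρ⁻¹)
      refine h3.congr_fderiv ?_
      ext v
      simp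
    exact h2.smul (hf.differentiable hk0 x).hasFDerivAt
  have hle : ∀ x, ‖fderiv ℝ g x‖ ≤ e := by
    intro x
    rw [(hfd x).fderiv]
    rcases le_or_gt ‖x‖ (2 * ρ) with hx | hx
    · have hxr : ‖x‖ < r := by rw [hρ] at hx; linarith
      have h2 : ‖χ (ρ⁻¹ • x) • fderiv ℝ f x‖ ≤ κ := by
        rw [norm_smul, Real.norm_of_nonneg χ.nonneg]
        calc _ ≤ 1 * κ := mul_le_mul χ.le_one (hrκ x hxr).le (norm_nonneg _) zero_le_one
          _ = κ := one_mul _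
      have h3 : ‖(ρ⁻¹ • fderiv ℝ χ (ρ⁻¹ • x)).smulRight (f x)‖ ≤ 2 * K * κ := by
        rw [ContinuousLinearMap.norm_smulRight_apply, norm_smul, norm_inv,
          Real.norm_of_nonneg hρ0.le]
        calc _ ≤ ρ⁻¹ * K * (κ * (2 * ρ)) := by
              gcongr
              · exact hK _
              · exact (hfx x hxr).trans (by gcongr)
          _ = _ := by field_simp
      refine (norm_add_le _ _).trans ((add_le_add h2 h3).trans (le_of_eq ?_))
      rw [hκ]; field_simp; ring
    · have hnot : ρ⁻¹ • x ∉ tsupport χ := by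
        rw [χ.tsupport_eq, mem_closedBall_zero_iff, norm_smul, norm_inv,
          Real.norm_of_nonneg hρ0.le, inv_mul_le_iff₀ hρ0]
        simp only [χ]
        linarith
      have h2 : χ (ρ⁻¹ • x) = 0 := image_eq_zero_of_notMem_tsupport hnot
      have h3 : fderiv ℝ χ (ρ⁻¹ • x) = 0 := by
        by_contra h
        exact hnot (support_fderiv_subset ℝ h)
      rw [h2, h3]
      simp [he.le]
  have hg0 : g 0 = 0 := by simp [g, h0]
  have hg1 : fderiv ℝ g 0 = 0 := by
    rw [(hfd 0).fderiv, h0, h1]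
    simp
  refine ⟨ρ, g, _, ∑ j ∈ Finset.range (k + 2), |C j|, hρ0, hg, hG, hle, ?_, hgeq⟩
  exact norm_le_mul_norm_sq_of_iteratedFDeriv_two_le
    (hg.of_le (by exact_mod_cast (by omega : 2 ≤ k + 1))) (hG 2 (by omega)) hg0 hg1

end Cutoff

/-! ### Slowly growing solutions and invariance -/

section IntegralCurve

variable {E : Type*} [NormedAddCommGroup E] [NormedSpace ℝ E] {F : E → E} {η : ℝ}

theorem IsIntegralCurveOn.ite_le {u y : ℝ → E} {v : ℝ → E → E} {a b : ℝ} (hab : a ≤ b)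
    (hu : IsIntegralCurveOn u v (Set.Icc a b)) (hy : IsIntegralCurveOn y v (Set.Ici b))
    (huy : u b = y b) :
    IsIntegralCurveOn (fun t => if t ≤ b then u t else y t) v (Set.Ici a) := by
  have hwu : Set.EqOn (fun t => if t ≤ b then u t else y t) u (Set.Icc a b) := fun t ht => by
    simp [ht.2]
  have hwy : Set.EqOn (fun t => if t ≤ b then u t else y t) y (Set.Ici b) := fun t ht => by
    rcases (Set.mem_Ici.1 ht).eq_or_lt with rfl | h
    · simpa using huy
    · simp [h.not_ge]
  intro t ht
  rw [← Set.Icc_union_Ici_eq_Ici hab]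
  refine HasDerivWithinAt.union ?_ ?_
  · by_cases h : t ∈ Set.Icc a b
    · have := (hu t h).congr hwu (hwu h)
      rwa [← hwu h] at this
    · exact HasFDerivWithinAt.of_notMem_closure (by rwa [isClosed_Icc.closure_eq])
  · by_cases h : t ∈ Set.Ici b
    · have := (hy t h).congr hwy (hwy h)
      rwa [← hwy h] at this
    · exact HasFDerivWithinAt.of_notMem_closure (by rwa [isClosed_Ici.closure_eq])

theorem IsIntegralCurveOn.comp_add_const {u : ℝ → E} {s s' : Set ℝ}
    (hu : IsIntegralCurveOn u (fun _ => F) s) (c : ℝ) (hs : ∀ t ∈ s', t + c ∈ s) :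
    IsIntegralCurveOn (fun t => u (t + c)) (fun _ => F) s' :=
  (hu.comp_add c).mono fun t ht => Set.mem_neg_vadd_set_iff.2 <| by
    simpa [vadd_eq_add, add_comm] using hs t ht

/-- The initial values of the solutions of `u' = F u` on `[0, ∞)` that grow at most like
`exp (η t)`. -/
def slowGrowthSet (F : E → E) (η : ℝ) : Set E :=
  {x | ∃ (y : ℝ → E) (M : ℝ), y 0 = x ∧ IsIntegralCurveOn y (fun _ => F) (Set.Ici 0) ∧
    ∀ t, 0 ≤ t → ‖y t‖ ≤ M * Real.exp (η * t)}

theorem mem_slowGrowthSet_of_isIntegralCurveOn {y : ℝ → E} {M : ℝ}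
    (hy : IsIntegralCurveOn y (fun _ => F) (Set.Ici 0))
    (hM : ∀ t, 0 ≤ t → ‖y t‖ ≤ M * Real.exp (η * t)) {s : ℝ} (hs : 0 ≤ s) :
    y s ∈ slowGrowthSet F η := by
  refine ⟨fun t => y (t + s), M * Real.exp (η * s), by simp,
    hy.comp_add_const s fun t ht => add_nonneg ht hs, fun t ht => ?_⟩
  refine (hM _ (add_nonneg ht hs)).trans (le_of_eq ?_)
  rw [mul_add, Real.exp_add]
  ring

/-- Prepending a compact arc to a slow solution only changes the constant; no uniqueness is needed
in this direction. -/
theorem mem_slowGrowthSet_of_ge (hη : 0 ≤ η) {u : ℝ → E} {a b : ℝ} (hab : a ≤ b)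
    (hu : IsIntegralCurveOn u (fun _ => F) (Set.Icc a b)) (hb : u b ∈ slowGrowthSet F η) :
    u a ∈ slowGrowthSet F η := by
  obtain ⟨y, M, hy0, hy, hM⟩ := hb
  obtain ⟨K, hK⟩ := isCompact_Icc.exists_bound_of_continuousOn hu.continuousOn
  have hw := hu.ite_le hab (hy.comp_add_const (s' := Set.Ici b) (-b) fun t ht => by
    simpa using ht) (by simp [hy0])
  refine ⟨_, |K| + |M|, ?_, hw.comp_add_const a fun t ht => by simpa using ht, ?_⟩
  · simp [hab]
  · intro t ht
    have h1 : 1 ≤ Real.exp (η * t) := Real.one_le_exp (by positivity)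
    rw [add_mul]
    split_ifs with h
    · have : ‖u (t + a)‖ ≤ |K| := (hK _ ⟨by linarith, h⟩).trans (le_abs_self _)
      nlinarith [abs_nonneg K, abs_nonneg M]
    · have h2 := hM (t + a + -b) (by linarith)
      have h3 : M * Real.exp (η * (t + a + -b)) ≤ |M| * Real.exp (η * t) := by
        gcongr
        · exact le_abs_self M
        · linarith
      have := mul_nonneg (abs_nonneg K) (Real.exp_pos (η * t)).le
      linarith

/-- Forward in time, the given arc must be identified with the slow solution, whence the Lipschitz
hypothesis. -/
theorem mem_slowGrowthSet_of_le {K : NNReal} (hF : LipschitzWith K F) {u : ℝ → E} {a b : ℝ}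
    (hab : a ≤ b) (hu : IsIntegralCurveOn u (fun _ => F) (Set.Icc a b))
    (ha : u a ∈ slowGrowthSet F η) : u b ∈ slowGrowthSet F η := by
  obtain ⟨y, M, hy0, hy, hM⟩ := ha
  have hy' := hy.comp_add_const (s' := Set.Icc a b) (-a) fun t ht => by simpa using ht.1
  have hIci : ∀ {z : ℝ → E}, IsIntegralCurveOn z (fun _ => F) (Set.Icc a b) →
      ∀ t ∈ Set.Ico a b, HasDerivWithinAt z (F (z t)) (Set.Ici t) t := fun hz t ht =>
    (hz t ⟨ht.1, ht.2.le⟩).mono_of_mem_nhdsWithin (Icc_mem_nhdsGE_of_mem ht)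
  have := ODE_solution_unique (v := fun _ => F) (fun _ => hF) hu.continuousOn (hIci hu)
    hy'.continuousOn (hIci hy') (by simp [hy0]) (Set.right_mem_Icc.2 hab)
  rw [this]
  exact mem_slowGrowthSet_of_isIntegralCurveOn hy hM (by linarith)

theorem mem_slowGrowthSet_of_ordConnected (hη : 0 ≤ η) {K : NNReal} (hF : LipschitzWith K F)
    {u : ℝ → E} {I : Set ℝ} (hI : I.OrdConnected) (hu : IsIntegralCurveOn u (fun _ => F) I)
    {s t : ℝ} (hs : s ∈ I) (ht : t ∈ I) (h : u s ∈ slowGrowthSet F η) :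
    u t ∈ slowGrowthSet F η := by
  rcases le_total s t with hst | hst
  · exact mem_slowGrowthSet_of_le hF hst (hu.mono (hI.out hs ht)) h
  · exact mem_slowGrowthSet_of_ge hη hst (hu.mono (hI.out ht hs)) h

end IntegralCurve

/-! ### Existence of the local manifold -/

theorem exists_isLocalCenterStableManifold {E : Type*} [NormedAddCommGroup E] [NormedSpace ℝ E]
    [FiniteDimensional ℝ E] [HasContDiffBump E] {k : ℕ} (hk : 1 ≤ k) {f : E → E} {p : E}
    (hf : ContDiff ℝ (k + 1 : ℕ) f) (hp : f p = 0) :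
    ∃ M : Set E, IsLocalCenterStableManifold k f p M := by
  have : CompleteSpace E := FiniteDimensional.complete ℝ E
  have hk0 : ((k + 1 : ℕ) : WithTop ℕ∞) ≠ 0 := by exact_mod_cast Nat.succ_ne_zero k
  set A := fderiv ℝ f p with hA
  obtain ⟨b, hb, P, Q, hPV, hVP, hQ, hdich⟩ := exists_isExpDichotomy A
  -- The largest rate for which `η, 2 η, …, (k + 1) η`, with a further `η` to spare, fit below the
  -- gap `b`.
  set η := b / (k + 2) with hη'
  have hη : 0 < η := by positivity
  obtain ⟨C, hC⟩ := hdich (η / 2) (by positivity)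
  set J := ∫ s : ℝ, Real.exp (-(η / 2) * |s|) with hJ
  have hJ0 : 0 ≤ J := integral_nonneg fun s => (Real.exp_pos _).le
  have hCJ : 0 ≤ C * J := mul_nonneg hC.const_nonneg hJ0
  set f₀ : E → E := fun x => f (x + p) - A x with hf₀
  have hf₀C : ContDiff ℝ (k + 1 : ℕ) f₀ :=
    (hf.comp (contDiff_id.add contDiff_const)).sub A.contDiff
  have hfd : HasFDerivAt f A p := (hf.differentiable hk0 p).hasFDerivAt
  have hf₀d : fderiv ℝ f₀ 0 = 0 := by
    have h1 : HasFDerivAt (fun x => f (x + p)) A 0 := by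
      rw [hasFDerivAt_comp_add_right, zero_add]
      exact hfd
    exact (h1.sub A.hasFDerivAt).fderiv.trans (sub_self A)
  -- The dichotomy constants are already fixed, so the cutoff can be taken with `C * J * e < 1`.
  obtain ⟨ρ, g, G, L, hρ, hg, hG, he, hL, hgf⟩ := exists_cutoff hk hf₀C (by simp [hf₀, hp]) hf₀d
    (e := 1 / (C * J + 1)) (by positivity)
  obtain ⟨Y, hYk, hPY, ⟨M, hM⟩, hYsol, hYuniq⟩ := hC.exists_global_centerStable hη hk
    (by rw [hη']; exact le_of_eq (by field_simp)) hg hG he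
    (by rw [← hJ, mul_one_div, div_lt_one (by positivity)]; linarith) hL hPV hVP
  set F : E → E := fun x => A x + g x with hF
  have hFlip : ∃ K, LipschitzWith K F := by
    have hglip : LipschitzWith (1 / (C * J + 1)).toNNReal g :=
      lipschitzWith_of_nnnorm_fderiv_le (𝕜 := ℝ) (hg.differentiable hk0) fun x => by
        rw [← NNReal.coe_le_coe, Real.coe_toNNReal _ (by positivity)]
        exact he x
    exact ⟨_, A.lipschitz.add hglip⟩
  obtain ⟨K, hFlip⟩ := hFlip
  have hFf : ∀ x ∈ Metric.ball p ρ, f x = F (x - p) := by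
    intro x hx
    have := hgf (x - p) (by rwa [← dist_eq_norm])
    simp [hF, this, hf₀]
  have hrange : Set.range Y = slowGrowthSet F η := by
    ext x
    constructor
    · rintro ⟨v, rfl⟩
      obtain ⟨y, M, hy0, hy, hM⟩ := hYsol v
      exact ⟨y, M, hy0, fun t ht => hy t ht, hM⟩
    · rintro ⟨y, M, rfl, hy, hM⟩
      exact ⟨_, (hYuniq y M (fun t ht => hy t ht) hM).symm⟩
  have hQY : ∀ v, Q (Y v) = Y v - v := by
    intro v
    rw [hC.eq_one_sub, sub_apply, hPY]
    rfl
  set φ : centerStableSubspace (A : E →ₗ[ℝ] E) → unstableSubspace (A : E →ₗ[ℝ] E) :=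
    fun v => Q.codRestrict _ hQ (Y v) with hφ
  have hφY : ∀ v, (φ v : E) = Y v - v := fun v => by simp [hφ, hQY]
  have hφM : ∀ v, ‖φ v‖ ≤ M * ‖v‖ ^ 2 := fun v => by
    have := hM v
    rwa [← hφY] at this
  have hgraph : ∀ x, (∃ v : centerStableSubspace (A : E →ₗ[ℝ] E), x = v + (φ v : E)) ↔
      x ∈ slowGrowthSet F η := by
    intro x
    rw [← hrange]
    simp only [hφY, add_sub_cancel, Set.mem_range, eq_comm]
  have hcurve : ∀ {I : Set ℝ} {u : ℝ → E}, IsIntegralCurveOn u (fun _ => f) I →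
      (∀ t ∈ I, u t ∈ Metric.ball p ρ) →
      IsIntegralCurveOn (fun t => u t - p) (fun _ => F) I := by
    intro I u hu huI t ht
    have := (hu t ht).sub_const p
    dsimp only at this ⊢
    rwa [hFf _ (huI t ht)] at this
  refine ⟨_, Metric.ball p ρ, Metric.isOpen_ball, Metric.mem_ball_self hρ,
    ⟨φ, (Q.codRestrict _ hQ).contDiff.comp hYk, ?_, ?_, rfl⟩, ?_, ρ, hρ, ?_⟩
  · simpa using hφM 0
  · refine Asymptotics.IsBigO.hasFDerivAt (n := 2) ?_ one_lt_two
    refine Asymptotics.IsBigO.of_bound M (Eventually.of_forall fun v => ?_)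
    simpa using hφM v
  · rintro I u hI hu huI ⟨s, hs, -, hsM⟩ t ht
    refine ⟨huI t ht, (hgraph _).2 ?_⟩
    exact mem_slowGrowthSet_of_ordConnected hη.le hFlip hI (hcurve hu huI) hs ht ((hgraph _).1 hsM)
  -- A solution that never leaves the ball solves the modified equation for all `t ≥ 0` and is
  -- bounded, hence slow.
  · intro u hu huρ t ht
    have huI : ∀ t ∈ Set.Ici (0 : ℝ), u t ∈ Metric.ball p ρ := fun t ht => by
      rw [Metric.mem_ball, dist_eq_norm]
      exact huρ t ht
    refine ⟨huI t ht, (hgraph _).2 ?_⟩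
    refine mem_slowGrowthSet_of_isIntegralCurveOn (y := fun t => u t - p) (M := ρ)
      (hcurve hu huI) (fun s hs => (huρ s hs).le.trans ?_) ht
    exact le_mul_of_one_le_right hρ.le (Real.one_le_exp (by positivity))

/-! ### Nonuniqueness: the saddle-node example -/

theorem mem_realSpectralSubspace_of_apply_eq_smul {E : Type*} [AddCommGroup E] [Module ℝ E]
    {A : E →ₗ[ℝ] E} {S : Set ℂ} {v : E} {r : ℝ} (h : A v = r • v) (hr : (r : ℂ) ∈ S) :
    v ∈ realSpectralSubspace A S := by
  rw [mem_realSpectralSubspace]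
  refine Submodule.mem_iSup_of_mem (r : ℂ) (Submodule.mem_iSup_of_mem hr ?_)
  refine Module.End.genEigenspace_le_maximal _ _ 1 ?_
  refine Module.End.mem_eigenspace_iff.2 ?_
  rw [LinearMap.baseChange_tmul, h, TensorProduct.tmul_smul, TensorProduct.smul_tmul',
    TensorProduct.smul_tmul', Complex.real_smul, smul_eq_mul]

theorem expNegInvGlue.hasDerivAt (x : ℝ) :
    HasDerivAt expNegInvGlue (x⁻¹ ^ 2 * expNegInvGlue x) x := by
  simpa using expNegInvGlue.hasDerivAt_polynomial_eval_inv_mul 1 x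

/-- The invariance equation `φ'(x) * x ^ 2 = φ(x)` of the curve `y = φ(x)` for `x' = x ^ 2`, `y' =
y`. At 0 both sides vanish. -/
theorem expNegInvGlue.deriv_mul_sq (x : ℝ) :
    x⁻¹ ^ 2 * expNegInvGlue x * x ^ 2 = expNegInvGlue x := by
  rcases eq_or_ne x 0 with rfl | hx
  · simp
  · field_simp

theorem expNegInvGlue.le_one (x : ℝ) : expNegInvGlue x ≤ 1 := by
  rcases le_or_gt x 0 with hx | hx
  · simp [expNegInvGlue.zero_of_nonpos hx]
  · rw [expNegInvGlue, if_neg hx.not_ge]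
    exact Real.exp_le_one_iff.2 (by simpa using hx.le)

theorem eq_mul_exp_of_hasDerivWithinAt_self {d : ℝ → ℝ} {I : Set ℝ} (hI : I.OrdConnected)
    (hd : ∀ t ∈ I, HasDerivWithinAt d (d t) I t) {s t : ℝ} (hs : s ∈ I) (ht : t ∈ I) :
    d t = d s * Real.exp (t - s) := by
  have h : ∀ t ∈ I, HasDerivWithinAt (fun t => d t * Real.exp (-t)) 0 I t := by
    intro t ht
    have h1 : HasDerivAt (fun t : ℝ => Real.exp (-t)) (Real.exp (-t) * -1) t :=
      (hasDerivAt_neg t).exp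
    refine ((hd t ht).mul h1.hasDerivWithinAt).congr_deriv ?_
    ring
  have := hI.convex.norm_image_sub_le_of_norm_hasDerivWithin_le (C := 0) h (by simp) hs ht
  rw [zero_mul, norm_le_zero_iff, sub_eq_zero] at this
  have h2 : d t = d t * Real.exp (-t) * Real.exp t := by
    rw [mul_assoc, ← Real.exp_add]; simp
  rw [h2, this, mul_assoc, ← Real.exp_add]
  congr 2
  ring

/-- The linear part at the origin of `x' = x ^ 2`, `y' = y`. -/
noncomputable def saddleNodeLinear : EuclideanSpace ℝ (Fin 2) →L[ℝ] EuclideanSpace ℝ (Fin 2) :=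
  (EuclideanSpace.proj (𝕜 := ℝ) (1 : Fin 2)).smulRight (EuclideanSpace.single 1 1)

/-- The vector field of the saddle-node system `x' = x ^ 2`, `y' = y`. -/
noncomputable def saddleNodeField (x : EuclideanSpace ℝ (Fin 2)) : EuclideanSpace ℝ (Fin 2) :=
  saddleNodeLinear x + x 0 ^ 2 • EuclideanSpace.single 0 1

theorem saddleNodeField_apply_zero (x : EuclideanSpace ℝ (Fin 2)) :
    saddleNodeField x 0 = x 0 ^ 2 := by
  simp [saddleNodeField, saddleNodeLinear]

theorem saddleNodeField_apply_one (x : EuclideanSpace ℝ (Fin 2)) : saddleNodeField x 1 = x 1 := by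
  simp [saddleNodeField, saddleNodeLinear]

theorem contDiff_saddleNodeField {m : WithTop ℕ∞} : ContDiff ℝ m saddleNodeField :=
  saddleNodeLinear.contDiff.add
    (((EuclideanSpace.proj (𝕜 := ℝ) (0 : Fin 2)).contDiff.pow 2).smul contDiff_const)

theorem fderiv_saddleNodeField_zero : fderiv ℝ saddleNodeField 0 = saddleNodeLinear := by
  have h : HasFDerivAt (fun x : EuclideanSpace ℝ (Fin 2) => x 0 ^ 2) (0 : _ →L[ℝ] ℝ) 0 := by
    simpa using (EuclideanSpace.proj (𝕜 := ℝ) (0 : Fin 2)).hasFDerivAt (x := 0) |>.pow 2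
  have := (saddleNodeLinear.hasFDerivAt (x := 0)).add
    (h.smul_const (EuclideanSpace.single (0 : Fin 2) (1 : ℝ)))
  exact this.fderiv.trans (by ext; simp)

theorem single_zero_mem_centerStableSubspace :
    EuclideanSpace.single (0 : Fin 2) (1 : ℝ) ∈
      centerStableSubspace (saddleNodeLinear : EuclideanSpace ℝ (Fin 2) →ₗ[ℝ] _) :=
  mem_realSpectralSubspace_of_apply_eq_smul (r := 0) (by simp [saddleNodeLinear]) (by simp)

theorem single_one_mem_unstableSubspace :
    EuclideanSpace.single (1 : Fin 2) (1 : ℝ) ∈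
      unstableSubspace (saddleNodeLinear : EuclideanSpace ℝ (Fin 2) →ₗ[ℝ] _) :=
  mem_realSpectralSubspace_of_apply_eq_smul (r := 1) (by simp [saddleNodeLinear]) (by simp)

theorem apply_one_eq_zero_of_mem_centerStableSubspace {v : EuclideanSpace ℝ (Fin 2)}
    (hv : v ∈ centerStableSubspace (saddleNodeLinear : EuclideanSpace ℝ (Fin 2) →ₗ[ℝ] _)) :
    v 1 = 0 := by
  have h0 := Submodule.sub_mem _ hv
    (Submodule.smul_mem _ (v 0) single_zero_mem_centerStableSubspace)
  have h1 : v - v 0 • EuclideanSpace.single (0 : Fin 2) (1 : ℝ) =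
      v 1 • EuclideanSpace.single (1 : Fin 2) (1 : ℝ) := by
    ext i; fin_cases i <;> simp
  have h2 := Submodule.smul_mem _ (v 1) single_one_mem_unstableSubspace
  rw [h1] at h0
  have := Submodule.disjoint_def.1
    (isCompl_centerStableSubspace_unstableSubspace _).disjoint _ h0 h2
  simpa using congrArg (fun x : EuclideanSpace ℝ (Fin 2) => x 1) this

/-- Along solutions the defect `d = y - c φ(x)` satisfies `d' = d`. So it vanishes identically once
it vanishes somewhere, and otherwise grows exponentially, which is impossible for a bounded solution
since `φ ≤ 1`. -/
theorem isLocalCenterStableManifold_saddleNode (k : ℕ) (c : ℝ) :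
    IsLocalCenterStableManifold k saddleNodeField 0
      {x | x 1 = c * expNegInvGlue (x 0)} := by
  unfold IsLocalCenterStableManifold
  rw [fderiv_saddleNodeField_zero]
  have hdist : ∀ {I : Set ℝ} {u : ℝ → EuclideanSpace ℝ (Fin 2)},
      IsIntegralCurveOn u (fun _ => saddleNodeField) I → ∀ t ∈ I,
      HasDerivWithinAt (fun t => u t 1 - c * expNegInvGlue (u t 0))
        (u t 1 - c * expNegInvGlue (u t 0)) I t := by
    intro I u hu t ht
    have h0 : HasDerivWithinAt (fun t => u t 0) (u t 0 ^ 2) I t := by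
      rw [← saddleNodeField_apply_zero]
      exact (EuclideanSpace.proj (𝕜 := ℝ) (0 : Fin 2)).hasFDerivAt.comp_hasDerivWithinAt t (hu t ht)
    have h1 : HasDerivWithinAt (fun t => u t 1) (u t 1) I t := by
      have := (EuclideanSpace.proj (𝕜 := ℝ) (1 : Fin 2)).hasFDerivAt.comp_hasDerivWithinAt t
        (hu t ht)
      refine this.congr_deriv ?_
      exact saddleNodeField_apply_one _
    have h2 := ((expNegInvGlue.hasDerivAt (u t 0)).comp_hasDerivWithinAt t h0).const_mul c
    rw [expNegInvGlue.deriv_mul_sq] at h2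
    exact h1.sub h2
  refine ⟨Set.univ, isOpen_univ, Set.mem_univ _,
    ⟨fun v => (c * expNegInvGlue ((v : EuclideanSpace ℝ (Fin 2)) 0)) •
      ⟨_, single_one_mem_unstableSubspace⟩, ?_, ?_, ?_, ?_⟩, ?_, 1, one_pos, ?_⟩
  · refine (contDiff_const.mul (expNegInvGlue.contDiff.comp ?_)).smul contDiff_const
    exact ((EuclideanSpace.proj (𝕜 := ℝ) (0 : Fin 2)).comp (Submodule.subtypeL _)).contDiff
  · simp
  · have h1 := ((expNegInvGlue.hasDerivAt 0).comp_hasFDerivAt_of_eq (0 : centerStableSubspace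
      (saddleNodeLinear : EuclideanSpace ℝ (Fin 2) →ₗ[ℝ] _))
      ((EuclideanSpace.proj (𝕜 := ℝ) (0 : Fin 2)).comp (Submodule.subtypeL _)).hasFDerivAt
      (by simp)).const_mul c
    refine (h1.smul_const _).congr_fderiv ?_
    ext
    simp
  · ext x
    simp only [Set.mem_ofPred_eq, Set.mem_univ, true_and, sub_zero]
    constructor
    · intro hx
      refine ⟨x 0 • ⟨_, single_zero_mem_centerStableSubspace⟩, ?_⟩
      ext i
      fin_cases i <;> simp [hx]
    · rintro ⟨v, rfl⟩
      simp [apply_one_eq_zero_of_mem_centerStableSubspace v.2]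
  · rintro I u hI hu - ⟨s, hs, hsM⟩ t ht
    have := eq_mul_exp_of_hasDerivWithinAt_self hI (hdist hu) hs ht
    rw [sub_eq_zero.2 hsM, zero_mul, sub_eq_zero] at this
    exact this
  · intro u hu hb t ht
    have hexp : ∀ s : ℝ, 0 ≤ s → _ := fun s hs =>
      eq_mul_exp_of_hasDerivWithinAt_self Set.ordConnected_Ici (hdist hu) (s := t)
        (t := t + s) ht (add_nonneg ht hs)
    refine sub_eq_zero.1 ?_
    by_contra hne
    set d := u t 1 - c * expNegInvGlue (u t 0) with hd
    have hd0 : 0 < |d| := abs_pos.2 hne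
    have hbd : ∀ s, 0 ≤ s → |d| * Real.exp s ≤ 1 + |c| := by
      intro s hs
      have h1 := hexp s hs
      rw [add_sub_cancel_left] at h1
      rw [← abs_of_pos (Real.exp_pos s), ← abs_mul, ← h1]
      refine (abs_sub _ _).trans (add_le_add ?_ ?_)
      · have := hb (t + s) (add_nonneg ht hs)
        rw [sub_zero] at this
        exact (PiLp.norm_apply_le (u (t + s)) 1).trans this.le
      · rw [abs_mul, abs_of_nonneg (expNegInvGlue.nonneg _)]
        exact mul_le_of_le_one_right (abs_nonneg c) (expNegInvGlue.le_one _)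
    -- At this time `exp s ≥ s + 1` already gives `|d| * exp s ≥ 1 + |c| + |d|`, beyond the bound.
    have h2 := hbd ((1 + |c|) / |d|) (by positivity)
    have h3 := Real.add_one_le_exp ((1 + |c|) / |d|)
    have h4 : |d| * ((1 + |c|) / |d| + 1) ≤ 1 + |c| := (by gcongr : _ ≤ _).trans h2
    rw [mul_add, mul_div_cancel₀ _ hd0.ne'] at h4
    linarith

/-- The points `(t, φ(t))` with `t > 0` tend to the origin and lie on the second curve, but not on
the axis because `φ(t) > 0`. -/
theorem saddleNode_graph_inter_ne {V : Set (EuclideanSpace ℝ (Fin 2))} (hV : V ∈ 𝓝 0) :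
    {x : EuclideanSpace ℝ (Fin 2) | x 1 = 0 * expNegInvGlue (x 0)} ∩ V ≠
      {x : EuclideanSpace ℝ (Fin 2) | x 1 = 1 * expNegInvGlue (x 0)} ∩ V := by
  intro h
  have hcont : Continuous fun t : ℝ => !₂[t, expNegInvGlue t] := by
    have := expNegInvGlue.contDiff (n := 0) |>.continuous
    fun_prop
  have h0 : Tendsto (fun t : ℝ => !₂[t, expNegInvGlue t]) (𝓝[>] 0) (𝓝 0) := by
    have h1 := hcont.tendsto 0
    have h2 : !₂[(0 : ℝ), expNegInvGlue 0] = 0 := by ext i; fin_cases i <;> simp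
    rw [h2] at h1
    exact h1.mono_left nhdsWithin_le_nhds
  obtain ⟨t, htV, ht⟩ := ((h0.eventually hV).and self_mem_nhdsWithin).exists
  have h1 : !₂[t, expNegInvGlue t] ∈
      {x : EuclideanSpace ℝ (Fin 2) | x 1 = 1 * expNegInvGlue (x 0)} ∩ V := ⟨by simp, htV⟩
  rw [← h] at h1
  have := h1.1
  simp at this
  exact this.not_gt ht

theorem proposition2p1 (k : ℕ) (hk : 1 ≤ k) :
    (∀ (n : ℕ) (f : EuclideanSpace ℝ (Fin n) → EuclideanSpace ℝ (Fin n))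
        (p : EuclideanSpace ℝ (Fin n)),
      ContDiff ℝ (k + 1) f → f p = 0 →
      ∃ M : Set (EuclideanSpace ℝ (Fin n)), IsLocalCenterStableManifold k f p M) ∧
    -- in general the manifold is not unique, not even as a germ at the equilibrium
    (∃ (n : ℕ) (f : EuclideanSpace ℝ (Fin n) → EuclideanSpace ℝ (Fin n))
        (p : EuclideanSpace ℝ (Fin n)),
      ContDiff ℝ (k + 1) f ∧ f p = 0 ∧
      ∃ M₁ M₂ : Set (EuclideanSpace ℝ (Fin n)),
        IsLocalCenterStableManifold k f p M₁ ∧ IsLocalCenterStableManifold k f p M₂ ∧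
        ∀ V ∈ 𝓝 p, M₁ ∩ V ≠ M₂ ∩ V) := by
  refine ⟨fun n f p hf hp => exists_isLocalCenterStableManifold hk (by exact_mod_cast hf) hp,
    2, saddleNodeField, 0, contDiff_saddleNodeField, ?_, _, _,
    isLocalCenterStableManifold_saddleNode k 0, isLocalCenterStableManifold_saddleNode k 1,
    fun V hV => saddleNode_graph_inter_ne hV⟩
  simp [saddleNodeField]
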